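/- **Setting.** Each particle has 21 standard basis states: $E_x,e_x,U_x,u_x,\overrightarrow{r}_x,\overrightarrow{d}_x,\mathrm{dn}_x$ with a qubit value $x\in\{0,1\}$, and $W,w,\mathrm{la},\mathrm{up},\mathrm{dup},\langle,\rangle$. Here $e,E$ are "entangled" states, $u,U$ "unentangled", $w,W$ "waiting", $\langle,\rangle$ are the end delimiters, and the control states are $\overrightarrow{r},\overrightarrow{d}$ (single/double right arrow), $\mathrm{la}$ (left arrow), $\mathrm{up},\mathrm{dup}$ (single/double left-end turn) and $\mathrm{dn}$ (right-end turn). A standard basis state of a chain is a string of these symbols. The transition rules are, for all $x,y\in\{0,1\}$: $\overrightarrow{r}_xU_y\to u_y\overrightarrow{r}_x$; $\overrightarrow{r}_xW\to w\overrightarrow{r}_x$; $\overrightarrow{r}_xE_y\to\mathrm{dn}_xE_y$; $w\,\mathrm{dn}_x\to\mathrm{la}\,E_x$; $w\,\mathrm{la}\to\mathrm{la}\,W$; $u_y\,\mathrm{la}\to\mathrm{la}\,U_y$; $e_y\,\mathrm{la}\to e_y\,\mathrm{up}$; $\mathrm{up}\,U_x\to e_x\overrightarrow{r}_x$; $\mathrm{dup}\,U_x\to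 e_x\overrightarrow{d}_x$; $\overrightarrow{d}_xU_y\to u_y\overrightarrow{d}_x$; $\overrightarrow{d}_xW\to w\overrightarrow{d}_x$; $\overrightarrow{d}_x\rangle\to\mathrm{dn}_x\rangle$. The state graph has an edge $z\to z'$ whenever a rule, applied to two neighbouring particles, takes the standard basis state $z$ to $z'$. The illegal pairs (left neighbour, right neighbour) are, for all qubit values unless specified: $\rangle$ followed by anything; anything followed by $\langle$; (upper case)(lower case); (control)(lower case); (upper case)(control); (control)(control); (lower case or $\langle$)(upper case or $\rangle$); $we$, $ue$; $EW$, $EU$; $u\,\mathrm{up}$, $u\,\mathrm{dup}$, $w\,\mathrm{up}$, $w\,\mathrm{dup}$; $\mathrm{dn}\,U$, $\mathrm{dn}\,W$; $wu$, $WU$; $\overrightarrow{d}E$, $\overrightarrow{r}\rangle$; $\langle\,\mathrm{up}$, $e\,\mathrm{dup}$, $\mathrm{dup}\,E$; $\mathrm{up}\,W$, $u\,\mathrm{dn}$, $e\,\mathrm{dn}$; and $e_x\overrightarrow{r}_y$, $e_x\overrightarrow{d}_y$ for $x\ne y$. Here lower case means $e,u,w$ and upper case means $E,U,W$. On a chain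 of $n$ particles let $H=3(H_{trans}+H_{legal}+H_{init})+H_{bracket}$. Here $H_{trans}$ is the sum, over all pairs of neighbouring particles and all rules $ab\to cd$, of $\frac12(|ab\rangle\langle ab|+|cd\rangle\langle cd|-|ab\rangle\langle cd|-|cd\rangle\langle ab|)$; $H_{legal}$ is the sum, over all pairs of neighbouring particles and all illegal pairs $ab$, of $|ab\rangle\langle ab|$; $H_{init}$ is the sum over all particles of $|U_-\rangle\langle U_-|$, where $|U_-\rangle=\frac1{\sqrt2}(|U_0\rangle-|U_1\rangle)$; and $H_{bracket}$ is the sum over all particles of the identity minus the projectors onto the two delimiter states $\langle$ and $\rangle$. Let $n=2m+3$. For $x\in\{0,1\}^m$ let $|\phi_x\rangle$ be the uniform superposition of the states in the path of the state graph that begins with $\langle\,\mathrm{dup}\,U_{x_1}\cdots U_{x_m}W^m\,\rangle$, and let $$|\phi_g\rangle=2^{-m/2}\sum_{x\in\{0,1\}^m}|\phi_x\rangle .$$ For an integer $s\ge0$ let $|\phi_1\rangle$ and $|\phi_2\rangle$ be the uniform superpositions of those standard basis states in these $2^m$ paths that have at most $s$, respectively at least $s+1$, particles in a state $e$; $|\phi_2\rangle$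 is the late-path component. Entropies are in bits: $S(\rho)=-\operatorname{Tr}\rho\log_2\rho$. **Statement.** 1. For every odd $n\ge3$, $|\phi_g\rangle$ is a ground state of $H$: a unit eigenvector whose eigenvalue is the smallest one. 2. Let $n\ge5$ be odd and let $s\ge0$ be an integer with $s\le(n-3)/4$. There is $c\in[\frac14,1]$ with $|\phi_g\rangle=\sqrt{1-c}\,|\phi_1\rangle+\sqrt c\,|\phi_2\rangle$. Moreover, for every integer $t$ with $s+2\le t\le n-s-2$, after tracing out the $t$ rightmost particles: (a) the reduced density matrix of $|\phi_2\rangle$, in the standard basis, is block diagonal with $2^s$ pairwise disjoint blocks indexed by $y\in\{0,1\}^s$, each of trace $2^{-s}$; block $y$ consists of the standard basis states of the remaining particles in which particles $2,\dots,s+1$ are in the states $e_{y_1},\dots,e_{y_s}$, and all matrix entries outside these diagonal blocks vanish; (b) the reduced density matrix of $|\phi_2\rangle$ has entropy at least $s$; (c) the reduced density matrix of $|\phi_g\rangle$ has entropy at least $s/4$. 3. Consequently the entropy is $\Omega(n)$: there is a constant $C>0$ such that for every odd $n\ge7$, with $s=\lfloor(n-3)/4\rfloor$, and every integer $t$ with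 $s+2\le t\le n-s-2$, the reduced state of $|\phi_g\rangle$ after tracing out the $t$ rightmost particles has entropy at least $Cn$. -/

import Mathlib

open scoped Matrix

/-- The 21 standard basis states of one particle; a Boolean argument is the value of the qubit
held by a two-state subsystem.
`E`, `e`: entangled; `U`, `u`: unentangled; `W`, `w`: waiting (upper case: right of the control
site, lower case: left of it); `ra`, `dra`: single and double right arrow; `la`: left arrow;
`up`, `dup`: single and double left-end turning states; `dn`: right-end turning state;
`lend`, `rend`: left and right end delimiters. -/
inductive Site : Type
  | E (x : Bool)
  | e (x : Bool)
  | U (x : Bool)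
  | u (x : Bool)
  | W
  | w
  | ra (x : Bool)
  | dra (x : Bool)
  | la
  | up
  | dup
  | dn (x : Bool)
  | lend
  | rend
  deriving DecidableEq, Fintype

/-- Standard basis states of a chain of `n` particles, written from left to right. -/
abbrev ChainState (n : ℕ) : Type := Fin n → Site

namespace Site

/-- Transition rules: `Rule (a, b) (c, d)` is the rule `a b → c d`. -/
inductive Rule : Site × Site → Site × Site → Prop
  | ra_U (x y : Bool) : Rule (ra x, U y) (u y, ra x)
  | ra_W (x : Bool) : Rule (ra x, W) (w, ra x)
  | ra_E (x y : Bool) : Rule (ra x, E y) (dn x, E y)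
  | w_dn (x : Bool) : Rule (w, dn x) (la, E x)
  | w_la : Rule (w, la) (la, W)
  | u_la (y : Bool) : Rule (u y, la) (la, U y)
  | e_la (y : Bool) : Rule (e y, la) (e y, up)
  | up_U (x : Bool) : Rule (up, U x) (e x, ra x)
  | dup_U (x : Bool) : Rule (dup, U x) (e x, dra x)
  | dra_U (x y : Bool) : Rule (dra x, U y) (u y, dra x)
  | dra_W (x : Bool) : Rule (dra x, W) (w, dra x)
  | dra_rend (x : Bool) : Rule (dra x, rend) (dn x, rend)

/-- The lower case states. -/
inductive IsLower : Site → Prop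
  | e (x : Bool) : IsLower (e x)
  | u (x : Bool) : IsLower (u x)
  | w : IsLower w

/-- The upper case states. -/
inductive IsUpper : Site → Prop
  | E (x : Bool) : IsUpper (E x)
  | U (x : Bool) : IsUpper (U x)
  | W : IsUpper W

/-- The control states. -/
inductive IsControl : Site → Prop
  | ra (x : Bool) : IsControl (ra x)
  | dra (x : Bool) : IsControl (dra x)
  | la : IsControl la
  | up : IsControl up
  | dup : IsControl dup
  | dn (x : Bool) : IsControl (dn x)

/-- Illegal pairs: `Illegal (a, b)` means that `a` immediately to the left of `b` is penalized. -/
inductive Illegal : Site × Site → Prop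
  | rend_any (a : Site) : Illegal (rend, a)
  | any_lend (a : Site) : Illegal (a, lend)
  | upper_lower (a b : Site) : IsUpper a → IsLower b → Illegal (a, b)
  | control_lower (a b : Site) : IsControl a → IsLower b → Illegal (a, b)
  | upper_control (a b : Site) : IsUpper a → IsControl b → Illegal (a, b)
  | control_control (a b : Site) : IsControl a → IsControl b → Illegal (a, b)
  | left_right (a b : Site) :
      (IsLower a ∨ a = lend) → (IsUpper b ∨ b = rend) → Illegal (a, b)
  | w_e (x : Bool) : Illegal (w, e x)
  | u_e (x y : Bool) : Illegal (u x, e y)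
  | E_W (x : Bool) : Illegal (E x, W)
  | E_U (x y : Bool) : Illegal (E x, U y)
  | u_up (x : Bool) : Illegal (u x, up)
  | u_dup (x : Bool) : Illegal (u x, dup)
  | w_up : Illegal (w, up)
  | w_dup : Illegal (w, dup)
  | dn_U (x y : Bool) : Illegal (dn x, U y)
  | dn_W (x : Bool) : Illegal (dn x, W)
  | w_u (x : Bool) : Illegal (w, u x)
  | W_U (x : Bool) : Illegal (W, U x)
  | dra_E (x y : Bool) : Illegal (dra x, E y)
  | ra_rend (x : Bool) : Illegal (ra x, rend)
  | lend_up : Illegal (lend, up)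
  | e_dup (x : Bool) : Illegal (e x, dup)
  | dup_E (x : Bool) : Illegal (dup, E x)
  | up_W : Illegal (up, W)
  | u_dn (x y : Bool) : Illegal (u x, dn y)
  | e_dn (x y : Bool) : Illegal (e x, dn y)
  | e_ra (x y : Bool) : x ≠ y → Illegal (e x, ra y)
  | e_dra (x y : Bool) : x ≠ y → Illegal (e x, dra y)

end Site

noncomputable section

/-! ### The Hamiltonian of the finite chain -/

/-- `|p⟩⟨q|`. -/
def ketbra {ι : Type*} [DecidableEq ι] (p q : ι) : Matrix ι ι ℂ := Matrix.single p q 1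

open Classical in
/-- The two-particle term built from the transition rules: the sum over all rules `p → q` of
`½ (|p⟩⟨p| + |q⟩⟨q| - |p⟩⟨q| - |q⟩⟨p|)`. -/
def transTerm : Matrix (Site × Site) (Site × Site) ℂ :=
  ∑ r : (Site × Site) × (Site × Site) with Site.Rule r.1 r.2,
    (1 / 2 : ℂ) • (ketbra r.1 r.1 + ketbra r.2 r.2 - ketbra r.1 r.2 - ketbra r.2 r.1)

open Classical in
/-- The two-particle term penalizing illegal pairs. -/
def legalTerm : Matrix (Site × Site) (Site × Site) ℂ :=
  ∑ p : Site × Site with Site.Illegal p, ketbra p p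

/-- The one-particle term `|U₋⟩⟨U₋|`, where `|U₋⟩ = (|U₀⟩ - |U₁⟩) / √2`. -/
def initTerm : Matrix Site Site ℂ :=
  (1 / 2 : ℂ) • (ketbra (Site.U false) (Site.U false) - ketbra (Site.U false) (Site.U true)
    - ketbra (Site.U true) (Site.U false) + ketbra (Site.U true) (Site.U true))

/-- The one-particle term penalizing all states other than the two delimiters. -/
def bracketTerm : Matrix Site Site ℂ :=
  1 - ketbra Site.lend Site.lend - ketbra Site.rend Site.rend

open Classical in
/-- The sum over all pairs of neighbouring particles of the two-particle term `h`, acting on the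
particles of the pair (in the order left, right) and as the identity on all others. -/
def sumPairs (n : ℕ) (h : Matrix (Site × Site) (Site × Site) ℂ) :
    Matrix (ChainState n) (ChainState n) ℂ :=
  Matrix.of fun z z' => ∑ p : Fin n × Fin n with p.2.val = p.1.val + 1,
    if ∀ k, k ≠ p.1 → k ≠ p.2 → z k = z' k then h (z p.1, z p.2) (z' p.1, z' p.2) else 0

open Classical in
/-- The sum over all particles of the one-particle term `h`, acting on that particle and as the
identity on all others. -/
def sumSites (n : ℕ) (h : Matrix Site Site ℂ) : Matrix (ChainState n) (ChainState n) ℂ :=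
  Matrix.of fun z z' => ∑ i : Fin n, if ∀ k, k ≠ i → z k = z' k then h (z i) (z' i) else 0

/-- `H = 3 (H_trans + H_legal + H_init) + H_bracket` on a chain of `n` particles. -/
def hamiltonian (n : ℕ) : Matrix (ChainState n) (ChainState n) ℂ :=
  (3 : ℂ) • (sumPairs n transTerm + sumPairs n legalTerm + sumSites n initTerm)
    + sumSites n bracketTerm

/-- `ψ` is a unit eigenvector of `H` whose eigenvalue is a lower bound for the energy of all
vectors. -/
def IsGroundState {ι : Type*} [Fintype ι] (H : Matrix ι ι ℂ) (ψ : ι → ℂ) : Prop :=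
  star ψ ⬝ᵥ ψ = 1 ∧
    ∃ E : ℝ, H *ᵥ ψ = (E : ℂ) • ψ ∧
      ∀ χ : ι → ℂ, E * (star χ ⬝ᵥ χ).re ≤ (star χ ⬝ᵥ (H *ᵥ χ)).re

/-! ### The state graph and the state `φ_g` -/

/-- The edges of the state graph: a transition rule applied to two neighbouring particles takes
`z` to `z'`. -/
def Step {n : ℕ} (z z' : ChainState n) : Prop :=
  ∃ i j : Fin n, j.val = i.val + 1 ∧ Site.Rule (z i, z j) (z' i, z' j) ∧
    ∀ k, k ≠ i → k ≠ j → z' k = z k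

/-- The state `lend dup U_{x 0} ⋯ U_{x (m-1)} W^m rend` of a chain of `2 m + 3` particles. -/
def startState {m : ℕ} (x : Fin m → Bool) : ChainState (2 * m + 3) := fun i =>
  if i.val = 0 then Site.lend
  else if i.val = 1 then Site.dup
  else if h : i.val - 2 < m then Site.U (x ⟨i.val - 2, h⟩)
  else if i.val < 2 * m + 2 then Site.W
  else Site.rend

open Classical in
/-- The states in the path of the state graph that begins with `startState x`. -/
def path {m : ℕ} (x : Fin m → Bool) : Finset (ChainState (2 * m + 3)) :=
  Finset.univ.filter fun z => Relation.ReflTransGen Step (startState x) z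

open Classical in
/-- The uniform superposition of the standard basis states in a finite set. -/
def uniformSuperposition {ι : Type*} (S : Finset ι) : ι → ℂ := fun z =>
  if z ∈ S then ((1 / √(S.card : ℝ) : ℝ) : ℂ) else 0

/-- `φ_g = 2^{-m/2} ∑_x φ_x`, where `φ_x` is the uniform superposition of the states in the path
beginning with `startState x`. -/
def groundState (m : ℕ) : ChainState (2 * m + 3) → ℂ :=
  ((1 / √((2 : ℝ) ^ m) : ℝ) : ℂ) • ∑ x : Fin m → Bool, uniformSuperposition (path x)

open Classical in
/-- The number of particles in a state `e`. -/
def countE {n : ℕ} (z : ChainState n) : ℕ :=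
  (Finset.univ.filter fun i => ∃ x, z i = Site.e x).card

open Classical in
/-- `φ_1`: the paths are broken at the point when `s + 1` particles are in state `e`; this is the
uniform superposition of all states before that point. -/
def earlyPart (m s : ℕ) : ChainState (2 * m + 3) → ℂ :=
  uniformSuperposition (Finset.univ.filter fun z =>
    (∃ x : Fin m → Bool, z ∈ path x) ∧ countE z < s + 1)

open Classical in
/-- `φ_2`: the uniform superposition of all states from that point on. -/
def latePart (m s : ℕ) : ChainState (2 * m + 3) → ℂ :=
  uniformSuperposition (Finset.univ.filter fun z =>
    (∃ x : Fin m → Bool, z ∈ path x) ∧ s + 1 ≤ countE z)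

/-! ### Reduced states and entropy -/

/-- The state with the particles of `a` on the left and those of `b` on the right. -/
def glue {n t : ℕ} (a : ChainState (n - t)) (b : ChainState t) : ChainState n := fun i =>
  if h : i.val < n - t then a ⟨i.val, h⟩ else b ⟨i.val - (n - t), by omega⟩

/-- The density matrix `|ψ⟩⟨ψ|`. -/
def densityMatrix {ι : Type*} (ψ : ι → ℂ) : Matrix ι ι ℂ := Matrix.vecMulVec ψ (star ψ)

/-- The partial trace over the `t` rightmost particles. -/
def traceOutRight {n : ℕ} (t : ℕ) (ρ : Matrix (ChainState n) (ChainState n) ℂ) :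
    Matrix (ChainState (n - t)) (ChainState (n - t)) ℂ :=
  Matrix.of fun a a' => ∑ b : ChainState t, ρ (glue a b) (glue a' b)

/-- The reduced density matrix of the pure state `ψ` after tracing out the `t` rightmost
particles. -/
def reducedState {n : ℕ} (t : ℕ) (ψ : ChainState n → ℂ) :
    Matrix (ChainState (n - t)) (ChainState (n - t)) ℂ :=
  traceOutRight t (densityMatrix ψ)

theorem reducedState_isHermitian {n : ℕ} (t : ℕ) (ψ : ChainState n → ℂ) :
    (reducedState t ψ).IsHermitian := by
  ext a a'
  simp [reducedState, traceOutRight, densityMatrix, Matrix.vecMulVec, mul_comm]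

/-- The von Neumann entropy `-Tr ρ log₂ ρ = -∑ λ log₂ λ`, in bits. -/
def vonNeumannEntropy {ι : Type*} [Fintype ι] [DecidableEq ι] (ρ : Matrix ι ι ℂ)
    (hρ : ρ.IsHermitian) : ℝ :=
  -∑ i, hρ.eigenvalues i * Real.logb 2 (hρ.eigenvalues i)

/-- The entropy of the reduced state of `ψ` after tracing out the `t` rightmost particles. -/
def entanglementEntropy {n : ℕ} (t : ℕ) (ψ : ChainState n → ℂ) : ℝ :=
  vonNeumannEntropy (reducedState t ψ) (reducedState_isHermitian t ψ)

open Classical in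
/-- The standard basis states of `k` particles in which, after the first particle, the next
`s` particles are in the states `e_{y 0}, …, e_{y (s-1)}`. -/
def block (k : ℕ) {s : ℕ} (y : Fin s → Bool) : Finset (ChainState k) :=
  Finset.univ.filter fun a =>
    ∀ (j : Fin s) (i : Fin k), i.val = j.val + 1 → a i = Site.e (y j)

end

/-! Every state on a path has one explicit form, given by the bit string and a code: the number `a`
of particles in state `e`, the phase of the round, and the position of the control state. In round
`a` the arrow takes bit `a - 1`, leaves one copy at the left end as `e`, carries another past the
remaining qubits and deposits it at the right end as `E`; the returning control state then shifts
the qubits back. The `e`s on the left and the `E`s on the right are thus mirror copies of a prefix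
of the bits.

Ground state. `H_trans` and `H_init` are nonnegative, and the diagonal part is at least `n - 2` on
every basis state, since every delimiter beyond one at each end causes an illegal pair
(`card_le_innerCount`). The superposition attains `n - 2`: the path states contain no illegal pair
and have delimiters exactly at the two ends; their set is closed under forward and backward steps
(`path_closed`), so `H_trans` vanishes; and it is closed under changing the bit of a particle in
state `U` (`update_codeState`), so `H_init` vanishes. State determines bits and code
(`codeState_injective`), so the paths are disjoint and equally long, and the ground state is one
uniform superposition over all path states.

Entropy. Once `s` particles are in state `E`, the right part of the chain reveals the first `s`
bits, and so does the left part through its `e`s. Round `a` has `4 (m - a) + 5` positions, so at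
least a quarter of them come late when `2 s ≤ m` (`card_codes_le`). The entropy bound avoids
concavity. The reduced state is `M Mᴴ` with `M` the matrix of amplitudes; the columns of `M` that
show `s` particles in state `E` have total weight `c`, split evenly among `2 ^ s` disjoint supports.
By Cauchy–Schwarz they contribute at most `c / 2 ^ s` to each eigenvalue (`le_vonNeumannEntropy`),
and a Gibbs inequality gives entropy at least `c * s` (`le_neg_sum_mul_logb`). Here `c = 1` for the
late part and `c ≥ 1 / 4` for the ground state. -/

noncomputable section

namespace Chain

/-! ### Explicit description of the paths -/

/-- The four phases of one round: the arrow moves right, it turns at the right end, it moves left,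
it turns at the left end. -/
inductive Phase : Type
  | right
  | dn
  | left
  | up
  deriving DecidableEq

instance : Fintype Phase := ⟨{.right, .dn, .left, .up}, fun κ => by cases κ <;> simp⟩

/-- A position on a path: the number of particles in a state `e`, the phase, and the position of
the control state. -/
abbrev Code : Type := Σ _ : ℕ, Σ _ : Phase, ℕ

/-- The bits of `x`, continued by `false`. -/
def bitAt {m : ℕ} (x : Fin m → Bool) (i : ℕ) : Bool := if h : i < m then x ⟨i, h⟩ else false

/-- The state with `a` particles in a state `e`, the control state `C` at position `p`, and
`b` particles in a state `E`. -/
def conf (m : ℕ) (X : ℕ → Bool) (a p b : ℕ) (C : Site) (i : ℕ) : Site :=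
  if i = 0 then .lend
  else if i ≤ a then .e (X (i - 1))
  else if i < p then (if i ≤ m then .u (X (i - 1)) else .w)
  else if i = p then C
  else if i < 2 * m + 2 - b then (if i ≤ m + 1 then .U (X (i - 2)) else .W)
  else if i < 2 * m + 2 then .E (X (2 * m + 1 - i))
  else .rend

/-- The control state in a given phase of the round with `a` particles in a state `e`. -/
def ctrl (X : ℕ → Bool) (a : ℕ) : Phase → Site
  | .right => if a = 1 then .dra (X (a - 1)) else .ra (X (a - 1))
  | .dn => .dn (X (a - 1))
  | .left => .la
  | .up => if a = 0 then .dup else .up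

/-- The number of particles in a state `E`. -/
def endCount (a : ℕ) : Phase → ℕ
  | .right => a - 1
  | .dn => a - 1
  | .left => a
  | .up => a

/-- The possible positions of the control state. -/
def positions (m a : ℕ) : Phase → Finset ℕ
  | .right => if a = 0 then ∅ else Finset.Icc (a + 1) (2 * m + 2 - a)
  | .dn => if a = 0 then ∅ else {2 * m + 2 - a}
  | .left => if a = 0 then ∅ else Finset.Icc (a + 1) (2 * m + 1 - a)
  | .up => {a + 1}

/-- The positions on a path. -/
def codes (m : ℕ) : Finset Code :=
  (Finset.range (m + 1)).sigma fun a => Finset.univ.sigma fun κ => positions m a κ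

/-- The state at a given position on the path of the bit string `X`. -/
def codeState (m : ℕ) (X : ℕ → Bool) (c : Code) : ChainState (2 * m + 3) := fun i =>
  conf m X c.1 c.2.2 (endCount c.1 c.2.1) (ctrl X c.1 c.2.1) i

theorem mem_codes {m a p : ℕ} {κ : Phase} :
    (⟨a, κ, p⟩ : Code) ∈ codes m ↔ a ≤ m ∧ p ∈ positions m a κ := by
  simp [codes]

theorem mem_positions_right {m a p : ℕ} :
    p ∈ positions m a .right ↔ 1 ≤ a ∧ a + 1 ≤ p ∧ p ≤ 2 * m + 2 - a := by
  unfold positions; split_ifs <;> simp <;> omega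

theorem mem_positions_dn {m a p : ℕ} :
    p ∈ positions m a .dn ↔ 1 ≤ a ∧ p = 2 * m + 2 - a := by
  unfold positions; split_ifs <;> simp <;> omega

theorem mem_positions_left {m a p : ℕ} :
    p ∈ positions m a .left ↔ 1 ≤ a ∧ a + 1 ≤ p ∧ p ≤ 2 * m + 1 - a := by
  unfold positions; split_ifs <;> simp <;> omega

theorem mem_positions_up {m a p : ℕ} : p ∈ positions m a .up ↔ p = a + 1 := by
  simp [positions]

theorem bounds_of_mem_codes {m a p : ℕ} {κ : Phase} (h : (⟨a, κ, p⟩ : Code) ∈ codes m) :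
    a ≤ m ∧ a < p ∧ p < 2 * m + 2 - endCount a κ ∧ endCount a κ ≤ a ∧ a ≤ endCount a κ + 1 := by
  rw [mem_codes] at h
  obtain ⟨h1, h2⟩ := h
  cases κ <;>
    simp only [mem_positions_right, mem_positions_dn, mem_positions_left, mem_positions_up,
      endCount] at * <;> omega

theorem isControl_ctrl (X : ℕ → Bool) (a : ℕ) (κ : Phase) : Site.IsControl (ctrl X a κ) := by
  cases κ <;> unfold ctrl <;> (try split_ifs) <;> constructor

section conf

variable {m a p b : ℕ} {X : ℕ → Bool} {C : Site}

theorem conf_e {i : ℕ} (h0 : 1 ≤ i) (h : i ≤ a) : conf m X a p b C i = .e (X (i - 1)) := by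
  unfold conf; split_ifs <;> first | rfl | omega

theorem conf_u {i : ℕ} (h : a < i) (hp : i < p) (hm : i ≤ m) :
    conf m X a p b C i = .u (X (i - 1)) := by
  unfold conf; split_ifs <;> first | rfl | omega

theorem conf_w {i : ℕ} (h : a < i) (hp : i < p) (hm : m < i) :
    conf m X a p b C i = .w := by
  unfold conf; split_ifs <;> first | rfl | omega

theorem conf_ctrl (h : a < p) : conf m X a p b C p = C := by
  unfold conf; split_ifs <;> first | rfl | omega

theorem conf_U {i : ℕ} (h : a < p) (hp : p < i) (hb : i < 2 * m + 2 - b) (hm : i ≤ m + 1) :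
    conf m X a p b C i = .U (X (i - 2)) := by
  unfold conf; split_ifs <;> first | rfl | omega

theorem conf_W {i : ℕ} (h : a < p) (hp : p < i) (hb : i < 2 * m + 2 - b) (hm : m + 1 < i) :
    conf m X a p b C i = .W := by
  unfold conf; split_ifs <;> first | rfl | omega

theorem conf_E {i : ℕ} (h : a < p) (hp : p < i) (hb : 2 * m + 2 - b ≤ i) (hi : i < 2 * m + 2) :
    conf m X a p b C i = .E (X (2 * m + 1 - i)) := by
  unfold conf; split_ifs <;> first | rfl | omega

theorem conf_rend {i : ℕ} (h : a < p) (hp : p < i) (hi : 2 * m + 2 ≤ i) :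
    conf m X a p b C i = .rend := by
  unfold conf; split_ifs <;> first | rfl | omega

theorem conf_congr {a' p' b' : ℕ} {C' : Site} {i : ℕ} (hp : i ≠ p) (hp' : i ≠ p')
    (ha : i ≤ a' ↔ i ≤ a) (h : i < p' ↔ i < p) (hb : i < 2 * m + 2 - b' ↔ i < 2 * m + 2 - b) :
    conf m X a' p' b' C' i = conf m X a p b C i := by
  simp only [conf, ha, h, hb, hp, hp', if_false]

/-- The possible values of `conf`, by position. -/
theorem conf_cases (h : a < p) (i : ℕ) :
    (i = 0 ∧ conf m X a p b C i = .lend) ∨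
    (1 ≤ i ∧ i ≤ a ∧ conf m X a p b C i = .e (X (i - 1))) ∨
    (a < i ∧ i < p ∧ i ≤ m ∧ conf m X a p b C i = .u (X (i - 1))) ∨
    (a < i ∧ i < p ∧ m < i ∧ conf m X a p b C i = .w) ∨
    (i = p ∧ conf m X a p b C i = C) ∨
    (p < i ∧ i < 2 * m + 2 - b ∧ i ≤ m + 1 ∧ conf m X a p b C i = .U (X (i - 2))) ∨
    (p < i ∧ i < 2 * m + 2 - b ∧ m + 1 < i ∧ conf m X a p b C i = .W) ∨
    (p < i ∧ 2 * m + 2 - b ≤ i ∧ i < 2 * m + 2 ∧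
      conf m X a p b C i = .E (X (2 * m + 1 - i))) ∨
    (p < i ∧ 2 * m + 2 ≤ i ∧ conf m X a p b C i = .rend) := by
  unfold conf; split_ifs <;> simp <;> omega

theorem eq_of_isControl_conf (h : a < p) {i : ℕ} (hc : Site.IsControl (conf m X a p b C i)) :
    i = p := by
  rcases conf_cases (m := m) (X := X) (b := b) (C := C) h i with
    h | h | h | h | h | h | h | h | h <;>
  first
  | exact h.1
  | (exfalso; simp only [h] at hc; cases hc)

end conf

/-! ### Steps between the states of a path -/

/-- States given by functions on `ℕ` let a step be checked by arithmetic of positions, without casts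
in `Fin`. -/
theorem step_of_nat {n : ℕ} {F F' : ℕ → Site} (i : ℕ) (hi : i + 1 < n)
    {q q' : Site × Site} (hr : Site.Rule q q')
    (h1 : F i = q.1) (h2 : F (i + 1) = q.2) (h3 : F' i = q'.1) (h4 : F' (i + 1) = q'.2)
    (h : ∀ k, k ≠ i → k ≠ i + 1 → F' k = F k) :
    Step (fun k : Fin n => F k) (fun k : Fin n => F' k) := by
  refine ⟨⟨i, by omega⟩, ⟨i + 1, hi⟩, rfl, ?_, ?_⟩
  · simpa [h1, h2, h3, h4] using hr
  · intro k hk1 hk2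
    exact h k (fun h => hk1 (Fin.ext h)) (fun h => hk2 (Fin.ext h))

section steps

variable {m a p : ℕ} (X : ℕ → Bool)

theorem step_up (ha : a < m) :
    Step (codeState m X ⟨a, .up, a + 1⟩) (codeState m X ⟨a + 1, .right, a + 2⟩) := by
  -- Only the opening of the first round uses the double control states, hence the separate case `a
  -- = 0`.
  rcases Nat.eq_zero_or_pos a with rfl | ha0
  · refine step_of_nat 1 (by omega) (Site.Rule.dup_U (X 0)) ?_ ?_ ?_ ?_ ?_
    · exact (conf_ctrl (by simp)).trans (by simp [ctrl])
    · exact conf_U (by simp) (by simp) (by simp [endCount]; omega) (by omega)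
    · exact conf_e le_rfl (by simp)
    · exact (conf_ctrl (by simp)).trans (by simp [ctrl])
    · intro k hk1 hk2
      exact conf_congr (by simp; omega) (by simp; omega) (by simp; omega) (by simp; omega)
        (by simp [endCount])
  · refine step_of_nat (a + 1) (by omega) (Site.Rule.up_U (X a)) ?_ ?_ ?_ ?_ ?_
    · exact (conf_ctrl (by simp)).trans (by simp [ctrl, ha0.ne'])
    · exact conf_U (by simp) (by simp) (by simp [endCount]; omega) (by omega)
    · exact conf_e (by omega) (by simp)
    · exact (conf_ctrl (by simp)).trans (by simp [ctrl, ha0.ne'])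
    · intro k hk1 hk2
      exact conf_congr (by simp; omega) (by simp; omega) (by simp; omega) (by simp; omega)
        (by simp [endCount])

theorem step_right (ha : 1 ≤ a) (ham : a ≤ m) (hp : a < p) (hp' : p < 2 * m + 2 - a) :
    Step (codeState m X ⟨a, .right, p⟩) (codeState m X ⟨a, .right, p + 1⟩) := by
  -- Passing the arrow moves its neighbour one place to the left: bit `p - 1` sits at `p + 1` as `U`
  -- and at `p` as `u`. This is why `conf` reads `X (i - 2)` right of the control state and `X (i -
  -- 1)` left of it.
  have hrule : ∃ q q' : Site × Site, Site.Rule q q' ∧ q.1 = ctrl X a .right ∧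
      q.2 = (if p + 1 ≤ m + 1 then .U (X (p - 1)) else .W) ∧
      q'.1 = (if p ≤ m then .u (X (p - 1)) else .w) ∧ q'.2 = ctrl X a .right := by
    by_cases h1 : a = 1 <;> by_cases h2 : p ≤ m <;> simp only [ctrl, h1, h2, if_true, if_false,
      Nat.add_le_add_iff_right]
    · exact ⟨_, _, .dra_U _ _, rfl, rfl, rfl, rfl⟩
    · exact ⟨_, _, .dra_W _, rfl, rfl, rfl, rfl⟩
    · exact ⟨_, _, .ra_U _ _, rfl, rfl, rfl, rfl⟩
    · exact ⟨_, _, .ra_W _, rfl, rfl, rfl, rfl⟩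
  obtain ⟨q, q', hr, h1, h2, h3, h4⟩ := hrule
  refine step_of_nat p (by omega) hr ?_ ?_ ?_ ?_ ?_
  · rw [h1]; exact conf_ctrl hp
  · rw [h2]; split_ifs
    · exact conf_U hp (by simp) (by simp [endCount]; omega) (by omega)
    · exact conf_W hp (by simp) (by simp [endCount]; omega) (by omega)
  · rw [h3]; split_ifs
    · exact conf_u hp (by simp) (by omega)
    · exact conf_w hp (by simp) (by omega)
  · rw [h4]; exact conf_ctrl (by simp; omega)
  · intro k hk1 hk2
    exact conf_congr (by simp; omega) (by simp; omega) (by simp) (by simp; omega)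
      (by simp [endCount])

theorem step_right_dn (ha : 1 ≤ a) (ham : a ≤ m) :
    Step (codeState m X ⟨a, .right, 2 * m + 2 - a⟩) (codeState m X ⟨a, .dn, 2 * m + 2 - a⟩) := by
  -- In the first round no particle is in state `E` yet, so the double arrow turns at the delimiter;
  -- later arrows turn at the last deposited `E`.
  rcases ha.eq_or_lt with rfl | ha1
  · refine step_of_nat (2 * m + 1) (by omega) (Site.Rule.dra_rend (X 0)) ?_ ?_ ?_ ?_ ?_
    · exact (conf_ctrl (by simp; omega)).trans (by simp [ctrl])
    · exact conf_rend (by simp; omega) (by simp) (by simp)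
    · exact (conf_ctrl (by simp; omega)).trans (by simp [ctrl])
    · exact conf_rend (by simp; omega) (by simp) (by simp)
    · intro k hk1 hk2
      exact conf_congr (by simp; omega) (by simp; omega) (by simp) (by simp)
        (by simp [endCount])
  · refine step_of_nat (2 * m + 2 - a) (by omega) (Site.Rule.ra_E (X (a - 1)) (X (a - 2)))
      ?_ ?_ ?_ ?_ ?_
    · rw [conf_ctrl (by simp; omega)]; simp [ctrl, ha1.ne']
    · rw [conf_E (by simp; omega) (by simp) (by simp [endCount]; omega) (by omega)]
      simp only; congr 2; omega
    · rw [conf_ctrl (by simp; omega)]; simp [ctrl]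
    · rw [conf_E (by simp; omega) (by simp) (by simp [endCount]; omega) (by omega)]
      simp only; congr 2; omega
    · intro k hk1 hk2
      exact conf_congr (by simp; omega) (by simp; omega) (by simp) (by simp)
        (by simp [endCount])

theorem step_dn (ha : 1 ≤ a) (ham : a ≤ m) :
    Step (codeState m X ⟨a, .dn, 2 * m + 2 - a⟩) (codeState m X ⟨a, .left, 2 * m + 1 - a⟩) := by
  have e1 : 2 * m + 1 - a + 1 = 2 * m + 2 - a := by omega
  refine step_of_nat (2 * m + 1 - a) (by omega) (Site.Rule.w_dn (X (a - 1))) ?_ ?_ ?_ ?_ ?_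
  · exact conf_w (by simp; omega) (by simp; omega) (by omega)
  · rw [e1]; exact conf_ctrl (by simp; omega)
  · exact conf_ctrl (by simp; omega)
  · rw [e1, conf_E (by simp; omega) (by simp; omega) (by simp [endCount]) (by omega)]
    simp only; congr 2; omega
  · intro k hk1 hk2
    exact conf_congr (by simp; omega) (by simp; omega) (by simp) (by simp; omega)
      (by simp [endCount]; omega)

theorem step_left (ha : 1 ≤ a) (ham : a ≤ m) (hp : a < p) (hp' : p < 2 * m + 1 - a) :
    Step (codeState m X ⟨a, .left, p + 1⟩) (codeState m X ⟨a, .left, p⟩) := by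
  have hrule : ∃ q q' : Site × Site, Site.Rule q q' ∧
      q.1 = (if p ≤ m then .u (X (p - 1)) else .w) ∧ q.2 = .la ∧ q'.1 = .la ∧
      q'.2 = (if p + 1 ≤ m + 1 then .U (X (p - 1)) else .W) := by
    by_cases h2 : p ≤ m <;> simp only [h2, if_true, if_false, Nat.add_le_add_iff_right]
    · exact ⟨_, _, .u_la _, rfl, rfl, rfl, rfl⟩
    · exact ⟨_, _, .w_la, rfl, rfl, rfl, rfl⟩
  obtain ⟨q, q', hr, h1, h2, h3, h4⟩ := hrule
  refine step_of_nat p (by omega) hr ?_ ?_ ?_ ?_ ?_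
  · rw [h1]; split_ifs
    · exact conf_u hp (by simp) (by omega)
    · exact conf_w hp (by simp) (by omega)
  · rw [h2]; exact conf_ctrl (by simp; omega)
  · rw [h3]; exact conf_ctrl (by simp; omega)
  · rw [h4]; split_ifs
    · exact conf_U hp (by simp) (by simp [endCount]; omega) (by omega)
    · exact conf_W hp (by simp) (by simp [endCount]; omega) (by omega)
  · intro k hk1 hk2
    exact conf_congr (by simp; omega) (by simp; omega) (by simp) (by simp; omega)
      (by simp [endCount])

theorem step_left_up (ha : 1 ≤ a) (ham : a ≤ m) :
    Step (codeState m X ⟨a, .left, a + 1⟩) (codeState m X ⟨a, .up, a + 1⟩) := by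
  refine step_of_nat a (by omega) (Site.Rule.e_la (X (a - 1))) ?_ ?_ ?_ ?_ ?_
  · exact conf_e ha le_rfl
  · exact conf_ctrl (by simp)
  · exact conf_e ha le_rfl
  · rw [conf_ctrl (by simp)]; simp [ctrl]; omega
  · intro k hk1 hk2
    exact conf_congr (by simp; omega) (by simp; omega) (by simp) (by simp)
      (by simp [endCount])

end steps

/-! ### Determinism -/

theorem rule_unique {q q₁ q₂ : Site × Site} (h₁ : Site.Rule q q₁) (h₂ : Site.Rule q q₂) :
    q₁ = q₂ := by
  cases h₁ <;> cases h₂ <;> rfl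

theorem rule_unique_left {q q₁ q₂ : Site × Site} (h₁ : Site.Rule q₁ q) (h₂ : Site.Rule q₂ q) :
    q₁ = q₂ := by
  cases h₁ <;> cases h₂ <;> rfl

/-- A control state that is the left partner of the transition rules that apply to it. -/
def ActsRight : Site → Prop
  | .ra _ => True
  | .dra _ => True
  | .up => True
  | .dup => True
  | _ => False

/-- The site of the control state in the pair to which a rule applies. -/
theorem rule_source {q q' : Site × Site} (h : Site.Rule q q') :
    (Site.IsControl q.1 ∧ ActsRight q.1) ∨ (Site.IsControl q.2 ∧ ¬ ActsRight q.2) := by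
  cases h <;> first
    | exact Or.inl ⟨by constructor, trivial⟩
    | exact Or.inr ⟨by constructor, fun h => h⟩

/-- The site of the control state in the pair that a rule produces. -/
theorem rule_target {q q' : Site × Site} (h : Site.Rule q q') :
    (Site.IsControl q'.2 ∧ ActsRight q'.2 ∧ q'.2 ≠ .dup) ∨
      (Site.IsControl q'.1 ∧ ¬ ActsRight q'.1) := by
  cases h <;> first
    | exact Or.inl ⟨by constructor, trivial, by simp⟩
    | exact Or.inr ⟨by constructor, fun h => h⟩

/-- The control state says whether the rule's pair extends to its right or to its left, so a single
control site fixes the pair, and the pair fixes the rule. -/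
theorem eq_of_step {n : ℕ} {z z₁ z₂ : ChainState n} (r : Fin n)
    (hr : ∀ i, Site.IsControl (z i) → i = r) (h₁ : Step z z₁) (h₂ : Step z z₂) : z₁ = z₂ := by
  obtain ⟨i, j, hij, hrule, ho⟩ := h₁
  obtain ⟨i', j', hij', hrule', ho'⟩ := h₂
  have hi : i = i' := by
    rcases rule_source hrule with ⟨h1, h2⟩ | ⟨h1, h2⟩ <;>
      rcases rule_source hrule' with ⟨h3, h4⟩ | ⟨h3, h4⟩ <;>
      have e1 := hr _ h1 <;> have e2 := hr _ h3
    · exact e1.trans e2.symm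
    · dsimp only at *; rw [e1] at h2; rw [e2] at h4; exact absurd h2 h4
    · dsimp only at *; rw [e1] at h2; rw [e2] at h4; exact absurd h4 h2
    · apply Fin.ext; have := congrArg Fin.val (e1.trans e2.symm); omega
  subst hi
  have hj : j = j' := Fin.ext (by omega)
  subst hj
  have h := rule_unique hrule hrule'
  funext k
  by_cases hk1 : k = i
  · rw [hk1]; exact congrArg Prod.fst h
  · by_cases hk2 : k = j
    · rw [hk2]; exact congrArg Prod.snd h
    · rw [ho k hk1 hk2, ho' k hk1 hk2]

/-- The backward analogue: the control state that a rule produces shows on which side of the pair it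
landed. Nothing is assumed about the control sites of the predecessors. -/
theorem eq_of_step_left {n : ℕ} {z z₁ z₂ : ChainState n} (r : Fin n)
    (hr : ∀ i, Site.IsControl (z i) → i = r) (h₁ : Step z₁ z) (h₂ : Step z₂ z) : z₁ = z₂ := by
  obtain ⟨i, j, hij, hrule, ho⟩ := h₁
  obtain ⟨i', j', hij', hrule', ho'⟩ := h₂
  have hi : i = i' := by
    rcases rule_target hrule with ⟨h1, h2, -⟩ | ⟨h1, h2⟩ <;>
      rcases rule_target hrule' with ⟨h3, h4, -⟩ | ⟨h3, h4⟩ <;>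
      have e1 := hr _ h1 <;> have e2 := hr _ h3
    · apply Fin.ext; have := congrArg Fin.val (e1.trans e2.symm); omega
    · dsimp only at *; rw [e1] at h2; rw [e2] at h4; exact absurd h2 h4
    · dsimp only at *; rw [e1] at h2; rw [e2] at h4; exact absurd h4 h2
    · exact e1.trans e2.symm
  subst hi
  have hj : j = j' := Fin.ext (by omega)
  subst hj
  have h := rule_unique_left hrule hrule'
  funext k
  by_cases hk1 : k = i
  · rw [hk1]; exact congrArg Prod.fst h
  · by_cases hk2 : k = j
    · rw [hk2]; exact congrArg Prod.snd h
    · rw [← ho k hk1 hk2, ← ho' k hk1 hk2]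

/-! ### The states of a path -/

theorem codeState_injOn_control {m : ℕ} {X : ℕ → Bool} {c : Code} (hc : c ∈ codes m) :
    ∃ r : Fin (2 * m + 3), r.val = c.2.2 ∧
      ∀ i, Site.IsControl (codeState m X c i) → i = r := by
  obtain ⟨a, κ, p⟩ := c
  have hb := bounds_of_mem_codes hc
  exact ⟨⟨p, by omega⟩, rfl, fun i hi => Fin.ext (eq_of_isControl_conf hb.2.1 hi)⟩

theorem codeState_control {m : ℕ} {X : ℕ → Bool} {c : Code} (hc : c ∈ codes m)
    {i : Fin (2 * m + 3)} (hi : i.val = c.2.2) : codeState m X c i = ctrl X c.1 c.2.1 := by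
  obtain ⟨a, κ, p⟩ := c
  have hb := bounds_of_mem_codes hc
  unfold codeState
  rw [hi]
  exact conf_ctrl hb.2.1

theorem startState_eq {m : ℕ} (x : Fin m → Bool) :
    startState x = codeState m (bitAt x) ⟨0, .up, 1⟩ := by
  funext ⟨i, hi⟩
  simp only [startState, codeState, conf, endCount, ctrl, bitAt]
  split_ifs <;> first | rfl | omega

/-- No rule produces `dup`. This shows that the start of a path has no predecessor. -/
theorem not_step_of_dup {n : ℕ} {z z' : ChainState n} (r : Fin n) (hr : z' r = .dup)
    (hz : ∀ i, Site.IsControl (z' i) → i = r) : ¬ Step z z' := by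
  rintro ⟨i, j, hij, hrule, -⟩
  rcases rule_target hrule with ⟨h1, -, h2⟩ | ⟨h1, h2⟩
  · have := hz _ h1
    dsimp only at this h2
    rw [this] at h2
    exact h2 hr
  · have := hz _ h1
    dsimp only at this h2
    rw [this, hr] at h2
    exact h2 trivial

/-- No rule applies to the last state of a path. -/
theorem not_step_final {m : ℕ} {X : ℕ → Bool} {z : ChainState (2 * m + 3)} :
    ¬ Step (codeState m X ⟨m, .up, m + 1⟩) z := by
  rintro ⟨i, j, hij, hrule, -⟩
  have hmem : (⟨m, .up, m + 1⟩ : Code) ∈ codes m := by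
    rw [mem_codes, mem_positions_up]; exact ⟨le_rfl, rfl⟩
  obtain ⟨r, hr, hctrl⟩ := codeState_injOn_control (X := X) hmem
  -- After round `m` no particle is left in state `U`, while the only rules that consume `up` or
  -- `dup` need a `U` on the right.
  have hne : ∀ y, codeState m X ⟨m, .up, m + 1⟩ j ≠ .U y := by
    intro y hy
    rcases conf_cases (m := m) (X := X) (b := m) (C := ctrl X m .up) (Nat.lt_succ_self m) j with
      h | h | h | h | h | h | h | h | h
    · exact absurd (h.2.symm.trans hy) (by simp)
    · exact absurd (h.2.2.symm.trans hy) (by simp)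
    · exact absurd (h.2.2.2.symm.trans hy) (by simp)
    · exact absurd (h.2.2.2.symm.trans hy) (by simp)
    · have := h.2.symm.trans hy
      unfold ctrl at this
      split_ifs at this
    · omega
    · exact absurd (h.2.2.2.symm.trans hy) (by simp)
    · exact absurd (h.2.2.2.symm.trans hy) (by simp)
    · exact absurd (h.2.2.symm.trans hy) (by simp)
  have hC : codeState m X ⟨m, .up, m + 1⟩ r = ctrl X m .up := codeState_control hmem hr
  have key : ∀ {q q' : Site × Site}, Site.Rule q q' →
      (q.1 = ctrl X m .up ∨ q.2 = ctrl X m .up) → (∃ y, q.2 = .U y) := by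
    intro q q' h hq
    unfold ctrl at hq
    cases h <;> split_ifs at hq <;> simp_all
  obtain ⟨y, hy⟩ := key hrule (by
    rcases rule_source hrule with ⟨h1, -⟩ | ⟨h1, -⟩
    · left; rw [← hC, ← hctrl _ h1]
    · right; rw [← hC, ← hctrl _ h1])
  exact hne y hy

/-- Each code except the final one has an explicit successor, and by determinism any step leads
there. -/
theorem step_codeState {m : ℕ} {X : ℕ → Bool} {c : Code} (hc : c ∈ codes m)
    {z : ChainState (2 * m + 3)} (h : Step (codeState m X c) z) :
    ∃ c' ∈ codes m, z = codeState m X c' := by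
  obtain ⟨r, -, hctrl⟩ := codeState_injOn_control (X := X) hc
  obtain ⟨a, κ, p⟩ := c
  have key : ∀ c' ∈ codes m, Step (codeState m X ⟨a, κ, p⟩) (codeState m X c') →
      ∃ c' ∈ codes m, z = codeState m X c' :=
    fun c' hc' hs => ⟨c', hc', eq_of_step r hctrl h hs⟩
  have hm := mem_codes.1 hc
  cases κ
  · obtain ⟨h0, h1, h2, h3⟩ := hm.1, mem_positions_right.1 hm.2
    rcases h3.lt_or_eq with h4 | rfl
    · refine key _ ?_ (step_right X (by omega) h0 (by omega) h4)
      rw [mem_codes, mem_positions_right]; omega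
    · refine key _ ?_ (step_right_dn X (by omega) h0)
      rw [mem_codes, mem_positions_dn]; omega
  · obtain ⟨h0, h1, rfl⟩ := hm.1, mem_positions_dn.1 hm.2
    refine key _ ?_ (step_dn X (by omega) h0)
    rw [mem_codes, mem_positions_left]; omega
  · obtain ⟨h0, h1, h2, h3⟩ := hm.1, mem_positions_left.1 hm.2
    rcases h2.lt_or_eq with h4 | rfl
    · obtain ⟨p, rfl⟩ : ∃ p', p = p' + 1 := ⟨p - 1, by omega⟩
      refine key _ ?_ (step_left X (by omega) h0 (by omega) (by omega))
      rw [mem_codes, mem_positions_left]; omega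
    · refine key _ ?_ (step_left_up X (by omega) h0)
      rw [mem_codes, mem_positions_up]; omega
  · obtain ⟨h0, rfl⟩ := hm.1, mem_positions_up.1 hm.2
    rcases h0.lt_or_eq with h4 | rfl
    · refine key _ ?_ (step_up X h4)
      rw [mem_codes, mem_positions_right]; omega
    · exact absurd h not_step_final

theorem reachable {m : ℕ} (X : ℕ → Bool) {c : Code} (hc : c ∈ codes m) :
    Relation.ReflTransGen Step (codeState m X ⟨0, .up, 1⟩) (codeState m X c) := by
  have hright : ∀ a, 1 ≤ a → a ≤ m →
      Relation.ReflTransGen Step (codeState m X ⟨0, .up, 1⟩) (codeState m X ⟨a, .right, a + 1⟩) →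
      ∀ p, a + 1 ≤ p → p ≤ 2 * m + 2 - a →
      Relation.ReflTransGen Step (codeState m X ⟨0, .up, 1⟩) (codeState m X ⟨a, .right, p⟩) := by
    intro a ha ham h p hp
    induction p, hp using Nat.le_induction with
    | base => exact fun _ => h
    | succ p hp ih => exact fun hp' => (ih (by omega)).tail (step_right X ha ham hp (by omega))
  have hdn : ∀ a, 1 ≤ a → a ≤ m →
      Relation.ReflTransGen Step (codeState m X ⟨0, .up, 1⟩) (codeState m X ⟨a, .right, a + 1⟩) →
      Relation.ReflTransGen Step (codeState m X ⟨0, .up, 1⟩)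
        (codeState m X ⟨a, .dn, 2 * m + 2 - a⟩) :=
    fun a ha ham h => (hright a ha ham h _ (by omega) le_rfl).tail (step_right_dn X ha ham)
  have hleft : ∀ a, 1 ≤ a → a ≤ m →
      Relation.ReflTransGen Step (codeState m X ⟨0, .up, 1⟩) (codeState m X ⟨a, .right, a + 1⟩) →
      ∀ p, a + 1 ≤ p → p ≤ 2 * m + 1 - a →
      Relation.ReflTransGen Step (codeState m X ⟨0, .up, 1⟩) (codeState m X ⟨a, .left, p⟩) := by
    intro a ha ham h p hp hp'
    -- The control state moves towards smaller positions in this phase, so the induction descends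
    -- from the turning point.
    induction hp' using Nat.decreasingInduction with
    | self => exact (hdn a ha ham h).tail (step_dn X ha ham)
    | of_succ p hp' ih =>
      exact (ih (by omega)).tail (step_left X ha ham hp (by omega))
  have hup : ∀ a, a ≤ m → Relation.ReflTransGen Step (codeState m X ⟨0, .up, 1⟩)
      (codeState m X ⟨a, .up, a + 1⟩) := by
    intro a
    induction a with
    | zero => exact fun _ => .refl
    | succ a ih =>
      intro ha
      exact (hleft _ (by omega) ha ((ih (by omega)).tail (step_up X ha)) _ le_rfl
        (by omega)).tail (step_left_up X (by omega) ha)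
  obtain ⟨a, κ, p⟩ := c
  have hm := mem_codes.1 hc
  have hstart : 1 ≤ a → Relation.ReflTransGen Step (codeState m X ⟨0, .up, 1⟩)
      (codeState m X ⟨a, .right, a + 1⟩) := by
    intro ha
    obtain ⟨a, rfl⟩ : ∃ a', a = a' + 1 := ⟨a - 1, by omega⟩
    exact (hup a (by omega)).tail (step_up X (by omega))
  cases κ
  · obtain ⟨h0, h1, h2, h3⟩ := hm.1, mem_positions_right.1 hm.2
    exact hright a h1 h0 (hstart h1) p h2 h3
  · obtain ⟨h0, h1, rfl⟩ := hm.1, mem_positions_dn.1 hm.2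
    exact hdn a h1 h0 (hstart h1)
  · obtain ⟨h0, h1, h2, h3⟩ := hm.1, mem_positions_left.1 hm.2
    exact hleft a h1 h0 (hstart h1) p h2 h3
  · obtain ⟨h0, rfl⟩ := hm.1, mem_positions_up.1 hm.2
    exact hup a h0

theorem mem_path {m : ℕ} {x : Fin m → Bool} {z : ChainState (2 * m + 3)} :
    z ∈ path x ↔ ∃ c ∈ codes m, z = codeState m (bitAt x) c := by
  simp only [path, Finset.mem_filter, Finset.mem_univ, true_and, startState_eq]
  constructor
  · intro h
    induction h with
    | refl => exact ⟨_, by rw [mem_codes, mem_positions_up]; omega, rfl⟩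
    | tail _ hs ih =>
      obtain ⟨c, hc, rfl⟩ := ih
      exact step_codeState hc hs
  · rintro ⟨c, hc, rfl⟩
    exact reachable _ hc

/-- Backward closure is the substantial half: a path state other than the start has a predecessor on
the path, and predecessors are unique; the start has none. This makes the uniform superposition a
zero vector of `H_trans`. -/
theorem path_closed {m : ℕ} {x : Fin m → Bool} {z z' : ChainState (2 * m + 3)} (h : Step z z') :
    z ∈ path x ↔ z' ∈ path x := by
  constructor
  · simp only [path, Finset.mem_filter, Finset.mem_univ, true_and]
    exact fun hz => hz.tail h
  · intro hz'
    obtain ⟨c, hc, rfl⟩ := mem_path.1 hz'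
    obtain ⟨r, -, hctrl⟩ := codeState_injOn_control (X := bitAt x) hc
    simp only [path, Finset.mem_filter, Finset.mem_univ, true_and] at hz' ⊢
    rcases hz'.cases_tail with h1 | ⟨w, hw, hs⟩
    · exfalso
      rw [h1] at h
      rw [h1] at hctrl
      have hdup : startState x ⟨1, by omega⟩ = .dup := by simp [startState]
      have hr := hctrl _ (hdup ▸ Site.IsControl.dup)
      exact not_step_of_dup _ (hr ▸ hdup) hctrl h
    · rwa [eq_of_step_left r hctrl h hs]

/-! ### The bits and the position are determined by the state -/

/-- The unique control site gives the position, its symbol gives the phase, and the first particle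
after the delimiter not in state `e` gives `a`. Every bit can then be read off. -/
theorem codeState_injective {m : ℕ} {x x' : Fin m → Bool} {c c' : Code} (hc : c ∈ codes m)
    (hc' : c' ∈ codes m) (h : codeState m (bitAt x) c = codeState m (bitAt x') c') :
    x = x' ∧ c = c' := by
  have hp : c.2.2 = c'.2.2 := by
    obtain ⟨r, hr, hctrl⟩ := codeState_injOn_control (X := bitAt x) hc
    obtain ⟨r', hr', hctrl'⟩ := codeState_injOn_control (X := bitAt x') hc'
    rw [← hr, ← hr', hctrl' r]
    rw [← h, codeState_control hc hr]
    exact isControl_ctrl _ _ _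
  have hC : ctrl (bitAt x) c.1 c.2.1 = ctrl (bitAt x') c'.1 c'.2.1 := by
    obtain ⟨r, hr, -⟩ := codeState_injOn_control (X := bitAt x) hc
    rw [← codeState_control hc hr, h, codeState_control hc' (hr.trans hp)]
  obtain ⟨a, κ, p⟩ := c
  obtain ⟨a', κ', p'⟩ := c'
  dsimp only at hp hC
  subst hp
  have hb := bounds_of_mem_codes hc
  have hb' := bounds_of_mem_codes hc'
  have hval : ∀ i, i < 2 * m + 3 →
      conf m (bitAt x) a p (endCount a κ) (ctrl (bitAt x) a κ) i =
        conf m (bitAt x') a' p (endCount a' κ') (ctrl (bitAt x') a' κ') i :=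
    fun i hi => congrFun h ⟨i, hi⟩
  have not_e : ∀ {X : ℕ → Bool} {a p b : ℕ} {C : Site} (_ : Site.IsControl C) (_ : a < p) (y : Bool),
      conf m X a p b C (a + 1) ≠ .e y := by
    intro X a p b C hC hap y hy
    rcases conf_cases (m := m) (X := X) (b := b) (C := C) hap (a + 1) with
      h | h | h | h | h | h | h | h | h <;> try omega
    all_goals first
      | (simp only [h] at hy; cases hy)
      | (rw [h.2] at hy; subst hy; cases hC)
  have ha : a = a' := by
    rcases lt_trichotomy a a' with h1 | h1 | h1
    · have := hval (a + 1) (by omega)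
      rw [conf_e (a := a') (by omega) h1] at this
      exact absurd this (not_e (isControl_ctrl _ _ _) hb.2.1 _)
    · exact h1
    · have := hval (a' + 1) (by omega)
      rw [conf_e (a := a) (by omega) h1] at this
      exact absurd this.symm (not_e (isControl_ctrl _ _ _) hb'.2.1 _)
  subst ha
  have hκ : κ = κ' := by
    unfold ctrl at hC
    cases κ <;> cases κ' <;> dsimp only at hC <;>
      (try split_ifs at hC) <;> first | rfl | cases hC
  subst hκ
  refine ⟨?_, rfl⟩
  funext ⟨j, hj⟩
  have hbit : ∀ x : Fin m → Bool, bitAt x j = x ⟨j, hj⟩ := fun x => by simp [bitAt, hj]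
  rw [← hbit x, ← hbit x']
  by_cases h1 : j < a
  · have := hval (j + 1) (by omega)
    rw [conf_e (by omega) h1, conf_e (by omega) h1] at this
    simpa using this
  -- Bit `j` sits at `j + 1` if that is left of the control state, and otherwise at `j + 2`.
  · by_cases h2 : j + 1 < p
    · have := hval (j + 1) (by omega)
      rw [conf_u (by omega) h2 hj, conf_u (by omega) h2 hj] at this
      simpa using this
    · have := hval (j + 2) (by omega)
      rw [conf_U hb.2.1 (by omega) (by omega) (by omega),
        conf_U hb.2.1 (by omega) (by omega) (by omega)] at this
      simpa using this

open Classical in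
theorem countE_codeState {m : ℕ} {X : ℕ → Bool} {c : Code} (hc : c ∈ codes m) :
    countE (codeState m X c) = c.1 := by
  obtain ⟨a, κ, p⟩ := c
  have hb := bounds_of_mem_codes hc
  have : (Finset.univ.filter fun i : Fin (2 * m + 3) => ∃ x, codeState m X ⟨a, κ, p⟩ i = .e x) =
      (Finset.Icc 1 a).attachFin (n := 2 * m + 3)
        (fun i hi => by have := Finset.mem_Icc.1 hi; omega) := by
    ext i
    simp only [Finset.mem_filter, Finset.mem_univ, true_and, Finset.mem_attachFin, Finset.mem_Icc]
    constructor
    · rintro ⟨y, hy⟩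
      unfold codeState at hy
      rcases conf_cases (m := m) (X := X) (b := endCount a κ) (C := ctrl X a κ) hb.2.1 i with
        h | h | h | h | h | h | h | h | h
      · simp only [h] at hy; cases hy
      · omega
      · simp only [h] at hy; cases hy
      · simp only [h] at hy; cases hy
      · have h3 := isControl_ctrl X a κ
        rw [← h.2] at h3; dsimp only at hy; rw [hy] at h3; cases h3
      all_goals simp only [h] at hy; cases hy
    · rintro ⟨h1, h2⟩
      exact ⟨_, conf_e h1 h2⟩
  unfold countE
  convert congrArg Finset.card this using 1
  simp

/-! ### Legality, delimiters, and unentangled qubits -/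

theorem not_illegal_codeState {m : ℕ} {X : ℕ → Bool} {c : Code} (hc : c ∈ codes m)
    {i j : Fin (2 * m + 3)} (hij : j.val = i.val + 1) :
    ¬ Site.Illegal (codeState m X c i, codeState m X c j) := by
  obtain ⟨a, κ, p⟩ := c
  have hb := bounds_of_mem_codes hc
  have hm := (mem_codes.1 hc).2
  unfold codeState
  have hj := j.isLt
  rw [hij] at hj ⊢
  generalize i.val = i at hj
  dsimp only
  have hi := conf_cases (m := m) (X := X) (b := endCount a κ) (C := ctrl X a κ) hb.2.1 i
  have hi' := conf_cases (m := m) (X := X) (b := endCount a κ) (C := ctrl X a κ) hb.2.1 (i + 1)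
  -- Three cases: the control state is the left member of the pair, the right member, or in neither
  -- place. Only the first two need the phase and the permitted positions.
  by_cases h1 : i = p
  · replace hi : conf m X a p (endCount a κ) (ctrl X a κ) i = ctrl X a κ := by
      rw [h1]; exact conf_ctrl hb.2.1
    rw [hi]
    generalize conf m X a p (endCount a κ) (ctrl X a κ) (i + 1) = B at hi' ⊢
    cases κ
    · have hp := mem_positions_right.1 hm
      have he : endCount a .right = a - 1 := rfl
      rcases hi' with h | h | h | h | h | h | h | h | h <;> try omega
      all_goals simp only [h, ctrl]
      all_goals split_ifs <;> try omega
      all_goals intro h; cases h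
      all_goals first
        | contradiction | (rename_i h1 h2; rcases h1 with h3 | h3 <;> contradiction)
    · have hp := mem_positions_dn.1 hm
      have he : endCount a .dn = a - 1 := rfl
      rcases hi' with h | h | h | h | h | h | h | h | h <;> try omega
      all_goals simp only [h, ctrl]
      all_goals intro h; cases h
      all_goals first
        | contradiction | (rename_i h1 h2; rcases h1 with h3 | h3 <;> contradiction)
    · have hp := mem_positions_left.1 hm
      have he : endCount a .left = a := rfl
      rcases hi' with h | h | h | h | h | h | h | h | h <;> try omega
      all_goals simp only [h, ctrl]
      all_goals intro h; cases h
      all_goals first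
        | contradiction | (rename_i h1 h2; rcases h1 with h3 | h3 <;> contradiction)
    · have hp := mem_positions_up.1 hm
      have he : endCount a .up = a := rfl
      rcases hi' with h | h | h | h | h | h | h | h | h <;> try omega
      all_goals simp only [h, ctrl]
      all_goals split_ifs <;> try omega
      all_goals intro h; cases h
      all_goals first
        | contradiction | (rename_i h1 h2; rcases h1 with h3 | h3 <;> contradiction)
  · by_cases h2 : i + 1 = p
    · replace hi' : conf m X a p (endCount a κ) (ctrl X a κ) (i + 1) = ctrl X a κ := by
        rw [h2]; exact conf_ctrl hb.2.1
      rw [hi']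
      generalize conf m X a p (endCount a κ) (ctrl X a κ) i = A at hi ⊢
      cases κ
      · have hp := mem_positions_right.1 hm
        rcases hi with h | h | h | h | h | h | h | h | h <;> try omega
        all_goals simp only [h, ctrl]
        all_goals split_ifs <;> try omega
        all_goals intro h; cases h
        -- The pair of `e` and an arrow with different bits is excluded because the last `e`, at
        -- position `a`, and the arrow both carry bit `a - 1`.
        all_goals first
          | (rename_i h3; have : i = a := (by omega); subst this; exact h3 rfl)
          | contradiction | (rename_i h1 h2; rcases h2 with h3 | h3 <;> contradiction)
      · have hp := mem_positions_dn.1 hm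
        rcases hi with h | h | h | h | h | h | h | h | h <;> try omega
        all_goals simp only [h, ctrl]
        all_goals intro h; cases h
        all_goals first | contradiction | (rename_i h1 h2; rcases h2 with h3 | h3 <;> contradiction)
      · have hp := mem_positions_left.1 hm
        rcases hi with h | h | h | h | h | h | h | h | h <;> try omega
        all_goals simp only [h, ctrl]
        all_goals intro h; cases h
        all_goals first | contradiction | (rename_i h1 h2; rcases h2 with h3 | h3 <;> contradiction)
      · have hp := mem_positions_up.1 hm
        rcases hi with h | h | h | h | h | h | h | h | h <;> try omega
        all_goals simp only [h, ctrl]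
        all_goals split_ifs <;> try omega
        all_goals intro h; cases h
        all_goals first | contradiction | (rename_i h1 h2; rcases h2 with h3 | h3 <;> contradiction)
    · generalize conf m X a p (endCount a κ) (ctrl X a κ) i = A at hi ⊢
      generalize conf m X a p (endCount a κ) (ctrl X a κ) (i + 1) = B at hi' ⊢
      rcases hi with h | h | h | h | h | h | h | h | h <;>
        rcases hi' with h' | h' | h' | h' | h' | h' | h' | h' | h' <;> try omega
      all_goals simp only [h, h']
      all_goals intro h; cases h
      all_goals first | contradiction | (rename_i h1 h2; rcases h1 with h3 | h3 <;> contradiction) |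
        (rename_i h1 h2; rcases h2 with h3 | h3 <;> contradiction)

theorem codeState_delimiter {m : ℕ} {X : ℕ → Bool} {c : Code} (hc : c ∈ codes m)
    (i : Fin (2 * m + 3)) :
    (codeState m X c i = .lend ∨ codeState m X c i = .rend) ↔ i.val = 0 ∨ i.val = 2 * m + 2 := by
  obtain ⟨a, κ, p⟩ := c
  have hb := bounds_of_mem_codes hc
  have hC := isControl_ctrl X a κ
  have hi := i.isLt
  unfold codeState
  dsimp only
  generalize i.val = i at hi
  have hcases := conf_cases (m := m) (X := X) (b := endCount a κ) (C := ctrl X a κ) hb.2.1 i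
  generalize conf m X a p (endCount a κ) (ctrl X a κ) i = A at hcases ⊢
  rcases hcases with h | h | h | h | h | h | h | h | h
  · simp [h]
  · simp [h]; omega
  · simp [h]; omega
  · simp [h]; omega
  · rw [h.2]
    generalize ctrl X a κ = C at *
    cases hC <;> simp <;> omega
  · simp [h]; omega
  · simp [h]; omega
  · simp [h]; omega
  · simp [h]; omega

/-- Changing the bit of an unentangled particle to the right of the control state yields the
corresponding state on another path. -/
theorem update_codeState {m : ℕ} {x : Fin m → Bool} {c : Code} (hc : c ∈ codes m)
    {i : Fin (2 * m + 3)} {y : Bool} (hy : codeState m (bitAt x) c i = .U y) (y' : Bool) :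
    ∃ x' : Fin m → Bool,
      Function.update (codeState m (bitAt x) c) i (.U y') = codeState m (bitAt x') c := by
  obtain ⟨a, κ, p⟩ := c
  have hb := bounds_of_mem_codes hc
  have hmem := mem_codes.1 hc
  have hi : p < i.val ∧ i.val < 2 * m + 2 - endCount a κ ∧ i.val ≤ m + 1 := by
    unfold codeState at hy
    dsimp only at hy
    have hcases :=
      conf_cases (m := m) (X := bitAt x) (b := endCount a κ) (C := ctrl (bitAt x) a κ) hb.2.1 i
    generalize conf m (bitAt x) a p (endCount a κ) (ctrl (bitAt x) a κ) i = A at hcases hy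
    rcases hcases with h | h | h | h | h | h | h | h | h
    · simp [h] at hy
    · simp [h] at hy
    · simp [h] at hy
    · simp [h] at hy
    · have hC := isControl_ctrl (bitAt x) a κ
      rw [← h.2, hy] at hC
      exact nomatch hC
    · exact ⟨h.1, h.2.1, h.2.2.1⟩
    · simp [h] at hy
    · simp [h] at hy
    · simp [h] at hy
  have hlt : i.val - 2 < m := by omega
  refine ⟨Function.update x ⟨i.val - 2, hlt⟩ y', ?_⟩
  have hbit : ∀ j, j ≠ i.val - 2 →
      bitAt (Function.update x ⟨i.val - 2, hlt⟩ y') j = bitAt x j := by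
    intro j hj
    unfold bitAt
    split_ifs with h
    · rw [Function.update_of_ne]
      intro h'
      exact hj (congrArg Fin.val h')
    · rfl
  have hbit' : bitAt (Function.update x ⟨i.val - 2, hlt⟩ y') (i.val - 2) = y' := by
    simp [bitAt, hlt]
  -- A `U` at position `i` holds bit `i - 2 ≥ a`, whereas the control state and the entangled
  -- particles only read bits below `a`; so the new bit string differs at this one particle only.
  have hctrl : ctrl (bitAt (Function.update x ⟨i.val - 2, hlt⟩ y')) a κ = ctrl (bitAt x) a κ := by
    cases κ <;> unfold ctrl <;> dsimp only <;> rw [hbit]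
    · have := mem_positions_right.1 hmem.2; omega
    · have := mem_positions_dn.1 hmem.2; omega
  funext k
  by_cases hk : k = i
  · subst hk
    rw [Function.update_self]
    refine ((conf_U hb.2.1 hi.1 hi.2.1 hi.2.2).trans ?_).symm
    rw [hbit']
  · rw [Function.update_of_ne hk]
    have hk' : k.val ≠ i.val := fun h => hk (Fin.ext h)
    unfold codeState
    simp only [hctrl, conf]
    split_ifs <;> first | rfl | (rw [hbit]; omega)

/-! ### Counting -/

theorem sum_phase {M : Type*} [AddCommMonoid M] (f : Phase → M) :
    ∑ κ, f κ = f .right + f .dn + f .left + f .up := by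
  have : (Finset.univ : Finset Phase) = {.right, .dn, .left, .up} := rfl
  rw [this]
  simp [add_assoc]

theorem card_positions {m a : ℕ} (ha : a ≤ m) :
    ∑ κ, (positions m a κ).card = if a = 0 then 1 else 4 * (m - a) + 5 := by
  rw [sum_phase]
  unfold positions
  split_ifs with h <;> simp; omega

theorem card_codes_lt (m s : ℕ) (hs : s ≤ m) :
    (((codes m).filter fun c => c.1 < s + 1).card : ℤ) = 1 + 4 * m * s - 2 * s ^ 2 + 3 * s := by
  have h : (codes m).filter (fun c => c.1 < s + 1) =
      (Finset.range (s + 1)).sigma fun a => Finset.univ.sigma fun κ => positions m a κ := by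
    ext ⟨a, κ, p⟩
    simp only [codes, Finset.mem_filter, Finset.mem_sigma, Finset.mem_range, Finset.mem_univ,
      true_and]
    exact ⟨fun h => ⟨h.2, h.1.2⟩, fun h => ⟨⟨by omega, h.2⟩, h.1⟩⟩
  rw [h, Finset.card_sigma]
  simp only [Finset.card_sigma]
  clear h
  induction s with
  | zero => rw [Finset.sum_range_one, card_positions hs]; simp
  | succ s ih =>
    rw [Finset.sum_range_succ, card_positions hs, Nat.cast_add, ih (by omega)]
    rw [if_neg (by omega)]
    push_cast [Nat.cast_sub hs]
    ring

theorem codes_filter_lt_self (m : ℕ) : (codes m).filter (fun c => c.1 < m + 1) = codes m := by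
  refine Finset.filter_true_of_mem ?_
  rintro ⟨a, κ, p⟩ hc
  exact Nat.lt_succ_of_le (mem_codes.1 hc).1

/-- At least a quarter of each path comes after the point when `s + 1` particles are in a
state `e`. -/
theorem card_codes_le (m s : ℕ) (hm : 1 ≤ m) (hs : 2 * s ≤ m) :
    (codes m).card ≤ 4 * ((codes m).filter fun c => s + 1 ≤ c.1).card := by
  have h1 := card_codes_lt m s (by omega)
  have h2 := card_codes_lt m m le_rfl
  rw [codes_filter_lt_self] at h2
  have h3 := Finset.card_filter_add_card_filter_not (s := codes m) (fun c => c.1 < s + 1)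
  simp only [not_lt] at h3
  generalize ((codes m).filter fun c => s + 1 ≤ c.1).card = L at h3 ⊢
  generalize ((codes m).filter fun c => c.1 < s + 1).card = K at h1 h3
  generalize (codes m).card = N at h2 h3 ⊢
  zify at h3 hs hm ⊢
  -- The late positions number `2 (m - s) ^ 2 + 3 (m - s)` out of `2 m ^ 2 + 3 m + 1`. As `2 (m - s)
  -- ≥ m`, four times the former is at least `2 m ^ 2 + 6 m`, and `m ≥ 1` covers the constant.
  obtain ⟨d, hd⟩ : ∃ d : ℤ, (m : ℤ) = 2 * s + d := ⟨m - 2 * s, by ring⟩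
  have hd0 : 0 ≤ d := by linarith
  have hs0 : (0 : ℤ) ≤ s := by positivity
  rw [hd] at h1 h2 hm
  nlinarith [mul_nonneg hd0 hs0, sq_nonneg d]

theorem card_bits_prefix (m s : ℕ) (hs : s ≤ m) (y : Fin s → Bool) :
    (Finset.univ.filter fun x : Fin m → Bool => ∀ j : Fin s, x (Fin.castLE hs j) = y j).card =
      2 ^ (m - s) := by
  have h : (Finset.univ.filter fun x : Fin m → Bool => ∀ j : Fin s, x (Fin.castLE hs j) = y j) =
      Fintype.piFinset fun i : Fin m =>
        if h : i.val < s then ({y ⟨i, h⟩} : Finset Bool) else Finset.univ := by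
    ext x
    simp only [Finset.mem_filter, Finset.mem_univ, true_and, Fintype.mem_piFinset]
    constructor
    · intro h i
      split_ifs with hi
      · simpa using h ⟨i, hi⟩
      · simp
    · intro h j
      have := h (Fin.castLE hs j)
      simpa using this
  rw [h, Fintype.card_piFinset]
  have h2 : ∀ i : Fin m, (if h : i.val < s then ({y ⟨i, h⟩} : Finset Bool) else Finset.univ).card =
      if i.val < s then 1 else 2 := by
    intro i; split_ifs <;> simp
  simp only [h2]
  rw [Fin.prod_univ_eq_prod_range (fun i => if i < s then 1 else 2) m]
  obtain ⟨d, rfl⟩ := Nat.exists_eq_add_of_le hs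
  rw [Finset.prod_range_add]
  rw [Finset.prod_congr rfl (fun i hi => if_pos (Finset.mem_range.1 hi))]
  simp

open Classical in
/-- The states at the positions `K` on the paths of the bit strings `T`. -/
def family (m : ℕ) (T : Finset (Fin m → Bool)) (K : Finset Code) : Finset (ChainState (2 * m + 3)) :=
  (T ×ˢ K).image fun q => codeState m (bitAt q.1) q.2

theorem mem_family {m : ℕ} {T : Finset (Fin m → Bool)} {K : Finset Code}
    {z : ChainState (2 * m + 3)} :
    z ∈ family m T K ↔ ∃ x ∈ T, ∃ c ∈ K, z = codeState m (bitAt x) c := by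
  simp only [family, Finset.mem_image, Finset.mem_product, Prod.exists]
  constructor
  · rintro ⟨x, c, ⟨hx, hc⟩, rfl⟩; exact ⟨x, hx, c, hc, rfl⟩
  · rintro ⟨x, hx, c, hc, rfl⟩; exact ⟨x, c, ⟨hx, hc⟩, rfl⟩

theorem card_family {m : ℕ} {T : Finset (Fin m → Bool)} {K : Finset Code} (hK : K ⊆ codes m) :
    (family m T K).card = T.card * K.card := by
  rw [family, Finset.card_image_of_injOn, Finset.card_product]
  rintro ⟨x, c⟩ h ⟨x', c'⟩ h' he
  simp only [Finset.coe_product, Set.mem_prod, Finset.mem_coe] at h h'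
  obtain ⟨rfl, rfl⟩ := codeState_injective (hK h.2) (hK h'.2) he
  rfl

theorem path_eq_family {m : ℕ} (x : Fin m → Bool) : path x = family m {x} (codes m) := by
  ext z
  simp [mem_path, mem_family]

open Classical in
theorem late_eq_family (m s : ℕ) :
    (Finset.univ.filter fun z : ChainState (2 * m + 3) =>
      (∃ x : Fin m → Bool, z ∈ path x) ∧ s + 1 ≤ countE z) =
    family m Finset.univ ((codes m).filter fun c => s + 1 ≤ c.1) := by
  ext z
  simp only [Finset.mem_filter, Finset.mem_univ, true_and, mem_family, mem_path]
  constructor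
  · rintro ⟨⟨x, c, hc, rfl⟩, h⟩
    exact ⟨x, c, ⟨hc, by rwa [countE_codeState hc] at h⟩, rfl⟩
  · rintro ⟨x, c, ⟨hc, h⟩, rfl⟩
    exact ⟨⟨x, c, hc, rfl⟩, by rwa [countE_codeState hc]⟩

open Classical in
theorem early_eq_family (m s : ℕ) :
    (Finset.univ.filter fun z : ChainState (2 * m + 3) =>
      (∃ x : Fin m → Bool, z ∈ path x) ∧ countE z < s + 1) =
    family m Finset.univ ((codes m).filter fun c => c.1 < s + 1) := by
  ext z
  simp only [Finset.mem_filter, Finset.mem_univ, true_and, mem_family, mem_path]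
  constructor
  · rintro ⟨⟨x, c, hc, rfl⟩, h⟩
    exact ⟨x, c, ⟨hc, by rwa [countE_codeState hc] at h⟩, rfl⟩
  · rintro ⟨x, c, ⟨hc, h⟩, rfl⟩
    exact ⟨⟨x, c, hc, rfl⟩, by rwa [countE_codeState hc]⟩

/-- The paths are disjoint and all have as many states as there are codes, so at each state exactly
one `x` contributes, always with the same amplitude. -/
theorem groundState_eq_uniformSuperposition (m : ℕ) :
    groundState m = uniformSuperposition (family m Finset.univ (codes m)) := by
  classical
  funext z
  simp only [groundState, Pi.smul_apply, Finset.sum_apply, smul_eq_mul, uniformSuperposition,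
    path_eq_family, card_family subset_rfl, Finset.card_singleton, one_mul, Finset.card_univ,
    Fintype.card_fun, Fintype.card_bool, Fintype.card_fin]
  by_cases hz : z ∈ family m Finset.univ (codes m)
  · rw [if_pos hz]
    obtain ⟨x, -, c, hc, rfl⟩ := mem_family.1 hz
    rw [Finset.sum_eq_single x]
    · rw [if_pos (mem_family.2 ⟨x, by simp, c, hc, rfl⟩), ← Complex.ofReal_mul]
      congr 1
      push_cast
      rw [Real.sqrt_mul (by positivity), div_mul_div_comm, one_mul]
    · intro x' _ hx'
      rw [if_neg]
      intro h
      obtain ⟨x'', hx'', c', hc', he⟩ := mem_family.1 h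
      rw [Finset.mem_singleton] at hx''
      exact hx' (hx'' ▸ (codeState_injective hc hc' he).1).symm
    · simp
  · rw [if_neg hz, Finset.sum_eq_zero, mul_zero]
    intro x _
    rw [if_neg]
    intro h
    obtain ⟨x', _, c, hc, rfl⟩ := mem_family.1 h
    exact hz (mem_family.2 ⟨x', Finset.mem_univ _, c, hc, rfl⟩)

theorem family_eq_path_union {m : ℕ} {z : ChainState (2 * m + 3)} :
    z ∈ family m Finset.univ (codes m) ↔ ∃ x : Fin m → Bool, z ∈ path x := by
  simp [mem_family, mem_path]

/-! ### Local operators -/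

section lens

variable {Z Q : Type*} [Fintype Z] [Fintype Q] {get : Z → Q} {put : Z → Q → Z}

/-- The states agreeing with `z` off the site are exactly the `put z q`, so a row of the local
operator reduces to a row of `h`. The abstract `get` and `put` serve single particles and pairs
alike. -/
theorem sum_agree_mul {agree : Z → Z → Prop} [∀ z z', Decidable (agree z z')]
    (get_put : ∀ z q, get (put z q) = q)
    (agree_iff : ∀ z z', agree z z' ↔ put z (get z') = z')
    (h : Matrix Q Q ℂ) (ψ : Z → ℂ) (z : Z) :
    ∑ z', (if agree z z' then h (get z) (get z') else 0) * ψ z' =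
      (h *ᵥ fun q => ψ (put z q)) (get z) := by
  symm
  refine Fintype.sum_of_injective (put z)
    (fun q q' hq => by rw [← get_put z q, hq, get_put]) _ _ ?_ ?_
  · intro z' hz'
    rw [if_neg, zero_mul]
    exact fun h => hz' ⟨_, (agree_iff z z').1 h⟩
  · intro q
    rw [if_pos ((agree_iff _ _).2 (by rw [get_put])), get_put]

/-- A local operator is nonnegative if it is nonnegative on the site that it acts on. -/
theorem re_sum_local_nonneg [Nonempty Q]
    (get_put : ∀ z q, get (put z q) = q) (put_get : ∀ z, put z (get z) = z)
    (put_put : ∀ z q q', put (put z q) q' = put z q')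
    {h : Matrix Q Q ℂ} (hh : ∀ f : Q → ℂ, 0 ≤ (star f ⬝ᵥ (h *ᵥ f)).re) (χ : Z → ℂ) :
    0 ≤ (∑ z, star (χ z) * (h *ᵥ fun q => χ (put z q)) (get z)).re := by
  set G : Z → ℂ := fun z => star (χ z) * (h *ᵥ fun q => χ (put z q)) (get z) with hG
  -- Exchanging the value at the site with the spare `q` is an involution. Hence the sum over all
  -- `z` and `q` of the form at `put z q` is the total form times the number of values `q`, while
  -- for fixed `z` it is the form of `h` on one slice.
  let σ : Z × Q → Z × Q := fun w => (put w.1 w.2, get w.1)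
  have hσ : Function.Involutive σ := by
    rintro ⟨w, q⟩
    simp [σ, get_put, put_put, put_get]
  have h1 : ∑ w : Z × Q, G (put w.1 w.2) = ∑ w : Z × Q, G w.1 :=
    Equiv.sum_comp hσ.toPerm (fun w => G w.1)
  have h2 : ∑ w : Z × Q, G w.1 = (Fintype.card Q : ℂ) * ∑ z, G z := by
    rw [Fintype.sum_prod_type, Finset.mul_sum]
    simp
  have h3 : 0 ≤ (∑ w : Z × Q, G (put w.1 w.2)).re := by
    rw [Fintype.sum_prod_type, Complex.re_sum]
    refine Finset.sum_nonneg fun z _ => ?_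
    have := hh fun q => χ (put z q)
    simpa [hG, dotProduct, get_put, put_put] using this
  rw [h1, h2] at h3
  have h4 : ((Fintype.card Q : ℂ) * ∑ z, G z).re = (Fintype.card Q : ℝ) * (∑ z, G z).re := by
    simp
  rw [h4] at h3
  exact nonneg_of_mul_nonneg_right h3 (by exact_mod_cast Fintype.card_pos)

end lens

theorem ketbra_mulVec {ι : Type*} [Fintype ι] [DecidableEq ι] (p q : ι) (f : ι → ℂ) :
    ketbra p q *ᵥ f = Pi.single p (f q) := by
  funext i
  simp only [ketbra, Matrix.mulVec, dotProduct, Matrix.single_apply, Pi.single_apply, ite_and,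
    ite_mul, one_mul, zero_mul]
  by_cases h : p = i
  · simp [h]
  · simp [h, Ne.symm h]

/-- The value is half of `|f a - f b| ^ 2`. Each transition rule, and the initial term, is an
operator of this shape. -/
theorem re_dotProduct_nonneg {ι : Type*} [Fintype ι] [DecidableEq ι] (f : ι → ℂ) (a b : ι) :
    0 ≤ (star f ⬝ᵥ (((1 / 2 : ℂ) * (f a - f b)) • (Pi.single a 1 - Pi.single b 1))).re := by
  rw [dotProduct_smul, dotProduct_sub, dotProduct_single, dotProduct_single]
  have : ((1 / 2 : ℂ) * (f a - f b)) • (star f a * 1 - star f b * 1) =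
      ((1 / 2 * Complex.normSq (f a - f b) : ℝ) : ℂ) := by
    push_cast
    rw [← Complex.mul_conj]
    simp
    ring
  rw [this, Complex.ofReal_re]
  have := Complex.normSq_nonneg (f a - f b)
  positivity

/-- Replace the states of the particles of a pair. -/
def putPair {n : ℕ} (p : Fin n × Fin n) (z : ChainState n) (q : Site × Site) : ChainState n :=
  Function.update (Function.update z p.1 q.1) p.2 q.2

section pair

variable {n : ℕ} {p : Fin n × Fin n}

theorem putPair_fst (hp : p.1 ≠ p.2) (z : ChainState n) (q : Site × Site) :
    putPair p z q p.1 = q.1 := by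
  simp [putPair, Function.update_of_ne hp]

theorem putPair_snd (z : ChainState n) (q : Site × Site) : putPair p z q p.2 = q.2 := by
  simp [putPair]

theorem putPair_of_ne (z : ChainState n) (q : Site × Site) {k : Fin n} (h1 : k ≠ p.1)
    (h2 : k ≠ p.2) : putPair p z q k = z k := by
  simp [putPair, h1, h2]

theorem putPair_ext {z z' : ChainState n} (h1 : z p.1 = z' p.1) (h2 : z p.2 = z' p.2)
    (h : ∀ k, k ≠ p.1 → k ≠ p.2 → z k = z' k) : z = z' := by
  funext k
  by_cases hk1 : k = p.1
  · rw [hk1, h1]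
  · by_cases hk2 : k = p.2
    · rw [hk2, h2]
    · exact h k hk1 hk2

theorem putPair_get (z : ChainState n) : putPair p z (z p.1, z p.2) = z := by
  simp [putPair]

theorem get_putPair (hp : p.1 ≠ p.2) (z : ChainState n) (q : Site × Site) :
    (putPair p z q p.1, putPair p z q p.2) = q := by
  rw [putPair_fst hp, putPair_snd]

theorem putPair_putPair (hp : p.1 ≠ p.2) (z : ChainState n) (q q' : Site × Site) :
    putPair p (putPair p z q) q' = putPair p z q' := by
  refine putPair_ext (p := p) ?_ ?_ ?_
  · rw [putPair_fst hp, putPair_fst hp]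
  · rw [putPair_snd, putPair_snd]
  · intro k h1 h2
    rw [putPair_of_ne _ _ h1 h2, putPair_of_ne _ _ h1 h2, putPair_of_ne _ _ h1 h2]

theorem putPair_agree (hp : p.1 ≠ p.2) (z z' : ChainState n) :
    (∀ k, k ≠ p.1 → k ≠ p.2 → z k = z' k) ↔ putPair p z (z' p.1, z' p.2) = z' := by
  constructor
  · intro h
    refine putPair_ext (p := p) ?_ ?_ ?_
    · rw [putPair_fst hp]
    · rw [putPair_snd]
    · intro k h1 h2
      rw [putPair_of_ne _ _ h1 h2, h k h1 h2]
  · intro h k h1 h2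
    rw [← h, putPair_of_ne _ _ h1 h2]

end pair

theorem ne_of_neighbour {n : ℕ} {p : Fin n × Fin n} (hp : p.2.val = p.1.val + 1) : p.1 ≠ p.2 :=
  fun h => by rw [h] at hp; omega

theorem sumPairs_mulVec {n : ℕ} (h : Matrix (Site × Site) (Site × Site) ℂ) (ψ : ChainState n → ℂ)
    (z : ChainState n) :
    (sumPairs n h *ᵥ ψ) z = ∑ p : Fin n × Fin n with p.2.val = p.1.val + 1,
      (h *ᵥ fun q => ψ (putPair p z q)) (z p.1, z p.2) := by
  simp only [Matrix.mulVec, dotProduct, sumPairs, Matrix.of_apply, Finset.sum_mul]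
  rw [Finset.sum_comm]
  refine Finset.sum_congr rfl fun p hp => ?_
  have hp := ne_of_neighbour (Finset.mem_filter.1 hp).2
  exact sum_agree_mul (get := fun z : ChainState n => (z p.1, z p.2)) (put := putPair p)
    (get_putPair hp) (putPair_agree hp) h ψ z

theorem sumSites_mulVec {n : ℕ} (h : Matrix Site Site ℂ) (ψ : ChainState n → ℂ)
    (z : ChainState n) :
    (sumSites n h *ᵥ ψ) z = ∑ i : Fin n, (h *ᵥ fun q => ψ (Function.update z i q)) (z i) := by
  simp only [Matrix.mulVec, dotProduct, sumSites, Matrix.of_apply, Finset.sum_mul]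
  rw [Finset.sum_comm]
  refine Finset.sum_congr rfl fun i _ => ?_
  refine sum_agree_mul (get := fun z : ChainState n => z i)
    (put := fun z q => Function.update z i q) (agree := fun z z' => ∀ k, k ≠ i → z k = z' k)
    (by simp) (fun z z' => ?_) h ψ z
  constructor
  · intro h
    funext k
    by_cases hk : k = i
    · subst hk; simp
    · simp [hk, h k hk]
  · intro h k hk
    rw [← h, Function.update_of_ne hk]

instance : Nonempty Site := ⟨.W⟩

theorem re_sumPairs_nonneg {n : ℕ} {h : Matrix (Site × Site) (Site × Site) ℂ}
    (hh : ∀ f, 0 ≤ (star f ⬝ᵥ (h *ᵥ f)).re) (χ : ChainState n → ℂ) :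
    0 ≤ (star χ ⬝ᵥ (sumPairs n h *ᵥ χ)).re := by
  simp only [dotProduct, sumPairs_mulVec, Finset.mul_sum]
  rw [Finset.sum_comm, Complex.re_sum]
  refine Finset.sum_nonneg fun p hp => ?_
  have hp := ne_of_neighbour (Finset.mem_filter.1 hp).2
  exact re_sum_local_nonneg (get := fun z : ChainState n => (z p.1, z p.2)) (put := putPair p)
    (get_putPair hp) putPair_get (putPair_putPair hp) hh χ

theorem re_sumSites_nonneg {n : ℕ} {h : Matrix Site Site ℂ}
    (hh : ∀ f, 0 ≤ (star f ⬝ᵥ (h *ᵥ f)).re) (χ : ChainState n → ℂ) :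
    0 ≤ (star χ ⬝ᵥ (sumSites n h *ᵥ χ)).re := by
  simp only [dotProduct, sumSites_mulVec, Finset.mul_sum]
  rw [Finset.sum_comm, Complex.re_sum]
  refine Finset.sum_nonneg fun i _ => ?_
  exact re_sum_local_nonneg (get := fun z : ChainState n => z i)
    (put := fun z q => Function.update z i q) (by simp) (by simp) (by simp) hh χ

/-! ### The terms of the Hamiltonian -/

open Classical in
theorem transTerm_mulVec (f : Site × Site → ℂ) :
    transTerm *ᵥ f =
      ∑ r : (Site × Site) × (Site × Site) with Site.Rule r.1 r.2,
        ((1 / 2 : ℂ) * (f r.1 - f r.2)) • (Pi.single r.1 1 - Pi.single r.2 1) := by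
  unfold transTerm
  rw [Matrix.sum_mulVec]
  refine Finset.sum_congr rfl fun r _ => ?_
  simp only [Matrix.smul_mulVec, Matrix.sub_mulVec, Matrix.add_mulVec, ketbra_mulVec]
  funext q
  simp only [Pi.smul_apply, Pi.sub_apply, Pi.add_apply, Pi.single_apply, smul_eq_mul]
  split_ifs <;> ring

theorem re_transTerm_nonneg (f : Site × Site → ℂ) : 0 ≤ (star f ⬝ᵥ (transTerm *ᵥ f)).re := by
  rw [transTerm_mulVec, dotProduct_sum, Complex.re_sum]
  refine Finset.sum_nonneg fun r _ => ?_
  exact re_dotProduct_nonneg f r.1 r.2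

theorem transTerm_mulVec_eq_zero {f : Site × Site → ℂ}
    (hf : ∀ q q', Site.Rule q q' → f q = f q') : transTerm *ᵥ f = 0 := by
  rw [transTerm_mulVec, Finset.sum_filter]
  refine Finset.sum_eq_zero fun r _ => ?_
  split_ifs with h
  · rw [hf _ _ h, sub_self, mul_zero, zero_smul]
  · rfl

theorem initTerm_mulVec (f : Site → ℂ) :
    initTerm *ᵥ f = ((1 / 2 : ℂ) * (f (.U false) - f (.U true))) •
      (Pi.single (.U false) 1 - Pi.single (.U true) 1) := by
  unfold initTerm
  simp only [Matrix.smul_mulVec, Matrix.sub_mulVec, Matrix.add_mulVec, ketbra_mulVec]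
  funext q
  simp only [Pi.smul_apply, Pi.sub_apply, Pi.add_apply, Pi.single_apply, smul_eq_mul]
  split_ifs <;> ring

theorem re_initTerm_nonneg (f : Site → ℂ) : 0 ≤ (star f ⬝ᵥ (initTerm *ᵥ f)).re := by
  rw [initTerm_mulVec]
  exact re_dotProduct_nonneg f _ _

open Classical in
theorem legalTerm_mulVec (f : Site × Site → ℂ) (q : Site × Site) :
    (legalTerm *ᵥ f) q = if Site.Illegal q then f q else 0 := by
  unfold legalTerm
  rw [Matrix.sum_mulVec, Finset.sum_apply]
  simp only [ketbra_mulVec, Pi.single_apply]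
  rw [Finset.sum_ite_eq]
  simp

theorem bracketTerm_mulVec (f : Site → ℂ) (q : Site) :
    (bracketTerm *ᵥ f) q = if q = .lend ∨ q = .rend then 0 else f q := by
  unfold bracketTerm
  simp only [Matrix.sub_mulVec, Matrix.one_mulVec, ketbra_mulVec, Pi.sub_apply, Pi.single_apply]
  by_cases h1 : q = .lend
  · subst h1; simp
  · by_cases h2 : q = .rend
    · subst h2; simp
    · simp [h1, h2]

open Classical in
/-- The number of illegal pairs in a standard basis state. -/
def illegalCount {n : ℕ} (z : ChainState n) : ℕ :=
  (Finset.univ.filter fun p : Fin n × Fin n =>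
    p.2.val = p.1.val + 1 ∧ Site.Illegal (z p.1, z p.2)).card

/-- The number of particles that are not in a delimiter state. -/
def innerCount {n : ℕ} (z : ChainState n) : ℕ :=
  (Finset.univ.filter fun i : Fin n => ¬ (z i = .lend ∨ z i = .rend)).card

theorem sumPairs_legalTerm_mulVec {n : ℕ} (ψ : ChainState n → ℂ) (z : ChainState n) :
    (sumPairs n legalTerm *ᵥ ψ) z = (illegalCount z : ℂ) * ψ z := by
  classical
  rw [sumPairs_mulVec]
  simp only [legalTerm_mulVec, putPair_get]
  rw [← Finset.sum_filter, Finset.filter_filter, Finset.sum_const, nsmul_eq_mul]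
  unfold illegalCount
  congr!

theorem sumSites_bracketTerm_mulVec {n : ℕ} (ψ : ChainState n → ℂ) (z : ChainState n) :
    (sumSites n bracketTerm *ᵥ ψ) z = (innerCount z : ℂ) * ψ z := by
  rw [sumSites_mulVec]
  simp only [bracketTerm_mulVec, Function.update_eq_self]
  rw [Finset.sum_ite, Finset.sum_const_zero, zero_add, Finset.sum_const, nsmul_eq_mul]
  rfl

/-- A left delimiter not at the first site is the right member of an illegal pair, and a right
delimiter not at the last site is the left member of one. So there are at most `2 + 2 * illegalCount
z` delimiters, and the weight 3 of the penalty is more than enough. -/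
theorem card_le_innerCount {n : ℕ} (z : ChainState n) :
    n ≤ innerCount z + 2 + 3 * illegalCount z := by
  classical
  have h1 := Finset.card_filter_add_card_filter_not (s := (Finset.univ : Finset (Fin n)))
    (fun i : Fin n => z i = .lend ∨ z i = .rend)
  rw [Finset.card_univ, Fintype.card_fin] at h1
  have hl : (Finset.univ.filter fun i : Fin n => z i = .lend).card ≤ illegalCount z + 1 := by
    have : (Finset.univ.filter fun i : Fin n => z i = .lend) ⊆
        ((Finset.univ.filter fun p : Fin n × Fin n =>
          p.2.val = p.1.val + 1 ∧ Site.Illegal (z p.1, z p.2)).image Prod.snd) ∪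
        (Finset.univ.filter fun i : Fin n => i.val = 0) := by
      intro i hi
      simp only [Finset.mem_filter, Finset.mem_univ, true_and, Finset.mem_union, Finset.mem_image,
        Prod.exists, exists_eq_right] at hi ⊢
      by_cases h0 : i.val = 0
      · exact Or.inr h0
      · refine Or.inl ⟨⟨i.val - 1, by omega⟩, by simp only; omega, ?_⟩
        rw [hi]
        exact .any_lend _
    refine (Finset.card_le_card this).trans ((Finset.card_union_le _ _).trans ?_)
    refine add_le_add (Finset.card_image_le.trans (by unfold illegalCount; convert le_rfl)) ?_
    rw [Finset.card_le_one]
    intro i hi j hj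
    simp only [Finset.mem_filter, Finset.mem_univ, true_and] at hi hj
    exact Fin.ext (hi.trans hj.symm)
  have hr : (Finset.univ.filter fun i : Fin n => z i = .rend).card ≤ illegalCount z + 1 := by
    have : (Finset.univ.filter fun i : Fin n => z i = .rend) ⊆
        ((Finset.univ.filter fun p : Fin n × Fin n =>
          p.2.val = p.1.val + 1 ∧ Site.Illegal (z p.1, z p.2)).image Prod.fst) ∪
        (Finset.univ.filter fun i : Fin n => i.val + 1 = n) := by
      intro i hi
      simp only [Finset.mem_filter, Finset.mem_univ, true_and, Finset.mem_union, Finset.mem_image,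
        Prod.exists, exists_and_right, exists_eq_right] at hi ⊢
      by_cases h0 : i.val + 1 = n
      · exact Or.inr h0
      · refine Or.inl ⟨⟨i.val + 1, by omega⟩, rfl, ?_⟩
        rw [hi]
        exact .rend_any _
    refine (Finset.card_le_card this).trans ((Finset.card_union_le _ _).trans ?_)
    refine add_le_add (Finset.card_image_le.trans (by unfold illegalCount; convert le_rfl)) ?_
    rw [Finset.card_le_one]
    intro i hi j hj
    simp only [Finset.mem_filter, Finset.mem_univ, true_and] at hi hj
    exact Fin.ext (by omega)
  rw [Finset.filter_or] at h1
  have h2 := Finset.card_union_le (Finset.univ.filter fun i : Fin n => z i = .lend)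
    (Finset.univ.filter fun i : Fin n => z i = .rend)
  unfold innerCount
  omega

theorem hamiltonian_mulVec {n : ℕ} (ψ : ChainState n → ℂ) :
    hamiltonian n *ᵥ ψ = (3 : ℂ) • (sumPairs n transTerm *ᵥ ψ) +
      (3 : ℂ) • (sumSites n initTerm *ᵥ ψ) +
      fun z => ((3 * illegalCount z + innerCount z : ℕ) : ℂ) * ψ z := by
  funext z
  simp only [hamiltonian, Matrix.add_mulVec, Matrix.smul_mulVec, Pi.add_apply, Pi.smul_apply,
    sumPairs_legalTerm_mulVec, sumSites_bracketTerm_mulVec, smul_eq_mul]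
  push_cast
  ring

/-- The energy is at least `n - 2`. -/
theorem le_energy {n : ℕ} (χ : ChainState n → ℂ) :
    ((n : ℝ) - 2) * (star χ ⬝ᵥ χ).re ≤ (star χ ⬝ᵥ (hamiltonian n *ᵥ χ)).re := by
  have h1 := re_sumPairs_nonneg re_transTerm_nonneg χ
  have h2 := re_sumSites_nonneg re_initTerm_nonneg χ
  rw [hamiltonian_mulVec, dotProduct_add, dotProduct_add, dotProduct_smul, dotProduct_smul,
    Complex.add_re, Complex.add_re]
  have h3 : ∀ v : ℂ, ((3 : ℂ) • v).re = 3 * v.re := fun v => by simp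
  rw [h3, h3]
  have h4 : ((n : ℝ) - 2) * (star χ ⬝ᵥ χ).re ≤
      (star χ ⬝ᵥ fun z => ((3 * illegalCount z + innerCount z : ℕ) : ℂ) * χ z).re := by
    simp only [dotProduct, Complex.re_sum, Finset.mul_sum]
    refine Finset.sum_le_sum fun z _ => ?_
    have h5 : (star χ z * (((3 * illegalCount z + innerCount z : ℕ) : ℂ) * χ z)).re =
        ((3 * illegalCount z + innerCount z : ℕ) : ℝ) * (star χ z * χ z).re := by
      rw [mul_left_comm, ← Complex.ofReal_natCast, Complex.re_ofReal_mul]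
    rw [h5]
    refine mul_le_mul_of_nonneg_right ?_ ?_
    · have := card_le_innerCount z
      have h6 : (n : ℝ) ≤ ((3 * illegalCount z + innerCount z : ℕ) : ℝ) + 2 := by
        exact_mod_cast (by omega : n ≤ 3 * illegalCount z + innerCount z + 2)
      linarith
    · rw [Pi.star_apply, Complex.star_def, ← Complex.normSq_eq_conj_mul_self, Complex.ofReal_re]
      exact Complex.normSq_nonneg _
  linarith

/-! ### The ground state -/

theorem star_dotProduct_uniformSuperposition {ι : Type*} [Fintype ι] {S : Finset ι}
    (hS : S.Nonempty) :
    star (uniformSuperposition S) ⬝ᵥ uniformSuperposition S = 1 := by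
  classical
  have hc : (0 : ℝ) < S.card := by exact_mod_cast hS.card_pos
  have h : ∀ z, star (uniformSuperposition S) z * uniformSuperposition S z =
      if z ∈ S then ((1 / (S.card : ℝ) : ℝ) : ℂ) else 0 := by
    intro z
    simp only [Pi.star_apply, uniformSuperposition]
    split_ifs
    · rw [Complex.star_def, Complex.conj_ofReal, ← Complex.ofReal_mul, div_mul_div_comm, one_mul,
        Real.mul_self_sqrt hc.le]
    · simp
  simp only [dotProduct, h]
  rw [Finset.sum_ite_mem, Finset.univ_inter, Finset.sum_const, nsmul_eq_mul,
    ← Complex.ofReal_natCast, ← Complex.ofReal_mul, mul_one_div_cancel hc.ne', Complex.ofReal_one]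

theorem mem_family_codes_iff {m : ℕ} {z : ChainState (2 * m + 3)} {i : Fin (2 * m + 3)}
    (y y' : Bool) (h : Function.update z i (.U y) ∈ family m Finset.univ (codes m)) :
    Function.update z i (.U y') ∈ family m Finset.univ (codes m) := by
  obtain ⟨x, -, c, hc, he⟩ := mem_family.1 h
  obtain ⟨x', hx'⟩ := update_codeState hc (x := x) (i := i) (y := y) (by rw [← he]; simp) y'
  rw [← he, Function.update_idem] at hx'
  exact mem_family.2 ⟨x', Finset.mem_univ _, c, hc, hx'⟩

theorem counts_codeState {m : ℕ} {X : ℕ → Bool} {c : Code} (hc : c ∈ codes m) :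
    illegalCount (codeState m X c) = 0 ∧ innerCount (codeState m X c) = 2 * m + 1 := by
  classical
  constructor
  · unfold illegalCount
    rw [Finset.card_eq_zero, Finset.filter_eq_empty_iff]
    rintro p - ⟨h1, h2⟩
    exact not_illegal_codeState hc h1 h2
  · unfold innerCount
    simp only [codeState_delimiter hc]
    have : (Finset.univ.filter fun i : Fin (2 * m + 3) => ¬ (i.val = 0 ∨ i.val = 2 * m + 2)) =
        (Finset.Icc 1 (2 * m + 1)).attachFin (n := 2 * m + 3)
          (fun i hi => by have := Finset.mem_Icc.1 hi; omega) := by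
      ext i
      simp only [Finset.mem_filter, Finset.mem_univ, true_and, Finset.mem_attachFin,
        Finset.mem_Icc]
      omega
    rw [this]
    simp

theorem codes_nonempty (m : ℕ) : (codes m).Nonempty :=
  ⟨⟨0, .up, 1⟩, by rw [mem_codes, mem_positions_up]; omega⟩

theorem family_nonempty {m : ℕ} {K : Finset Code} (hK : K.Nonempty) :
    (family m Finset.univ K).Nonempty := by
  obtain ⟨c, hc⟩ := hK
  exact ⟨_, mem_family.2 ⟨fun _ => false, Finset.mem_univ _, c, hc, rfl⟩⟩

theorem isGroundState_groundState (m : ℕ) :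
    IsGroundState (hamiltonian (2 * m + 3)) (groundState m) := by
  classical
  rw [groundState_eq_uniformSuperposition]
  set S := family m Finset.univ (codes m) with hS
  set φ := uniformSuperposition S with hφ
  refine ⟨star_dotProduct_uniformSuperposition (family_nonempty (codes_nonempty m)),
    -- The energy `n - 2` is the bracket term of a state with exactly two delimiters.
    ((2 * m + 3 : ℕ) : ℝ) - 2, ?_, le_energy⟩
  have hcongr : ∀ z z', (z ∈ S ↔ z' ∈ S) → φ z = φ z' := by
    intro z z' h
    by_cases h' : z' ∈ S <;> simp [hφ, uniformSuperposition, h, h']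
  have h1 : sumPairs (2 * m + 3) transTerm *ᵥ φ = 0 := by
    funext z
    rw [sumPairs_mulVec]
    refine Finset.sum_eq_zero fun p hp => ?_
    have hp' := (Finset.mem_filter.1 hp).2
    rw [transTerm_mulVec_eq_zero]
    · rfl
    · intro q q' hq
      have hstep : Step (putPair p z q) (putPair p z q') := by
        refine ⟨p.1, p.2, hp', ?_, ?_⟩
        · rwa [get_putPair (ne_of_neighbour hp'), get_putPair (ne_of_neighbour hp')]
        · intro k hk1 hk2
          rw [putPair_of_ne _ _ hk1 hk2, putPair_of_ne _ _ hk1 hk2]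
      apply hcongr
      rw [hS, family_eq_path_union, family_eq_path_union]
      exact exists_congr fun x => path_closed hstep
  have h2 : sumSites (2 * m + 3) initTerm *ᵥ φ = 0 := by
    funext z
    rw [sumSites_mulVec]
    refine Finset.sum_eq_zero fun i _ => ?_
    rw [initTerm_mulVec, hcongr (Function.update z i (.U false)) (Function.update z i (.U true))
      ⟨mem_family_codes_iff _ _, mem_family_codes_iff _ _⟩]
    simp
  rw [hamiltonian_mulVec, h1, h2, smul_zero, add_zero, zero_add]
  funext z
  rw [Pi.smul_apply, smul_eq_mul]
  by_cases hz : z ∈ S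
  · obtain ⟨x, -, c, hc, rfl⟩ := mem_family.1 hz
    rw [(counts_codeState hc).1, (counts_codeState hc).2]
    push_cast
    ring
  · simp [hφ, uniformSuperposition, hz]

/-! ### Lower bounds on the entropy -/

/-- If a part of weight `c` of a probability distribution is bounded by `c / 2 ^ s` in a basis,
then the entropy is at least `c * s`. -/
theorem le_neg_sum_mul_logb {ι : Type*} [Fintype ι] {l q : ι → ℝ} {c : ℝ} {s : ℕ}
    (hq0 : ∀ i, 0 ≤ q i) (hql : ∀ i, q i ≤ l i) (hl : ∑ i, l i = 1) (hc : ∑ i, q i = c)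
    (hqs : ∀ i, q i ≤ c / 2 ^ s) : c * s ≤ -∑ i, l i * Real.logb 2 (l i) := by
  have hl0 : ∀ i, 0 ≤ l i := fun i => (hq0 i).trans (hql i)
  have hl1 : ∀ i, l i ≤ 1 := fun i =>
    hl ▸ Finset.single_le_sum (fun i _ => hl0 i) (Finset.mem_univ i)
  have hc0 : 0 ≤ c := hc ▸ Finset.sum_nonneg fun i _ => hq0 i
  have hlog2 : 0 < Real.log 2 := Real.log_pos (by norm_num)
  -- The correction terms `q i - c * l i` sum to zero, so this pointwise bound suffices. It comes
  -- from replacing the factor `l i` by `q i`, as `log (l i) ≤ 0`, and splitting `l i` as `(q i / c)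
  -- * (l i * c / q i)`: the first logarithm is at most `-s log 2`, the second is bounded by `log t
  -- ≤ t - 1`.
  have key : ∀ i, s * q i + (q i - c * l i) / Real.log 2 ≤ -(l i * Real.logb 2 (l i)) := by
    intro i
    rw [Real.logb, ← mul_div_assoc, ← neg_div]
    have h : s * q i * Real.log 2 + (q i - c * l i) ≤ -(l i * Real.log (l i)) := by
      have hlogl : Real.log (l i) ≤ 0 := Real.log_nonpos (hl0 i) (hl1 i)
      rcases (hq0 i).eq_or_lt with h0 | h0
      · rw [← h0]
        have := mul_nonneg hc0 (hl0 i)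
        have := mul_nonneg (hl0 i) (neg_nonneg.2 hlogl)
        linarith
      · have hlpos : 0 < l i := h0.trans_le (hql i)
        have hcpos : 0 < c := by
          by_contra hneg
          have hle := hqs i
          rw [le_antisymm (not_lt.1 hneg) hc0, zero_div] at hle
          linarith
        have h1 : Real.log (l i) = Real.log (q i / c) + Real.log (l i * c / q i) := by
          rw [← Real.log_mul (by positivity) (by positivity)]
          congr 1
          field_simp
        have h2 : Real.log (l i * c / q i) ≤ l i * c / q i - 1 :=
          Real.log_le_sub_one_of_pos (by positivity)
        have h3 : Real.log (q i / c) ≤ -(s * Real.log 2) := by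
          rw [← Real.log_pow, ← Real.log_inv]
          refine Real.log_le_log (by positivity) ?_
          rw [div_le_iff₀ hcpos, inv_mul_eq_div]
          exact hqs i
        have h4 : q i * Real.log (l i) ≤ q i * (-(s * Real.log 2) + (l i * c / q i - 1)) :=
          mul_le_mul_of_nonneg_left (by linarith) h0.le
        have h5 : q i * (l i * c / q i) = l i * c := by field_simp
        have h6 : l i * Real.log (l i) ≤ q i * Real.log (l i) :=
          mul_le_mul_of_nonpos_right (hql i) hlogl
        linarith
    have h7 : s * q i + (q i - c * l i) / Real.log 2 =
        (s * q i * Real.log 2 + (q i - c * l i)) / Real.log 2 := by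
      field_simp
    rw [h7]
    exact div_le_div_of_nonneg_right h hlog2.le
  rw [← Finset.sum_neg_distrib]
  refine le_trans (le_of_eq ?_) (Finset.sum_le_sum fun i _ => key i)
  rw [Finset.sum_add_distrib, ← Finset.mul_sum, ← Finset.sum_div, Finset.sum_sub_distrib,
    ← Finset.mul_sum, hl, hc]
  ring

theorem sum_norm_sq_inner {ι : Type*} [Fintype ι] [DecidableEq ι]
    (v : OrthonormalBasis ι ℂ (EuclideanSpace ℂ ι)) (w : ι → ℂ) :
    ∑ i, ‖∑ a, star (v i a) * w a‖ ^ 2 = ∑ a, ‖w a‖ ^ 2 := by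
  have h := v.sum_sq_norm_inner_right (WithLp.toLp 2 w)
  rw [EuclideanSpace.norm_sq_eq] at h
  rw [← h]
  refine Finset.sum_congr rfl fun i _ => ?_
  congr 2
  simp [PiLp.inner_apply, mul_comm]

/-- The columns in `G` contribute to each eigenvalue a share `q i`, with total `c`. Columns with
label `k` live on `P k`, so they see only the part of the eigenvector on `P k`; as these parts are
disjoint, `q i ≤ c / 2 ^ s`. The columns outside `G` are unrestricted, so no block structure of `ρ`
itself is needed. -/
theorem le_vonNeumannEntropy {A B L : Type*} [Fintype A] [DecidableEq A] [Fintype B]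
    [Fintype L] [DecidableEq L] {ρ : Matrix A A ℂ} (hρ : ρ.IsHermitian) (M : Matrix A B ℂ)
    (hM : ρ = M * Mᴴ) (htr : ∑ b, ∑ a, ‖M a b‖ ^ 2 = 1) (G : Finset B) (label : B → L)
    (P : L → Finset A) (hP : ∀ k k', k ≠ k' → Disjoint (P k) (P k'))
    (hsupp : ∀ b ∈ G, ∀ a, M a b ≠ 0 → a ∈ P (label b)) {c : ℝ} {s : ℕ}
    (hL : (Fintype.card L : ℝ) = 2 ^ s)
    (hw : ∀ k, ∑ b ∈ G with label b = k, ∑ a, ‖M a b‖ ^ 2 = c / 2 ^ s) :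
    c * s ≤ vonNeumannEntropy ρ hρ := by
  set v := hρ.eigenvectorBasis with hv
  let W : A → B → ℂ := fun i b => ∑ a, star (v i a) * M a b
  have hpars : ∀ b, ∑ i, ‖W i b‖ ^ 2 = ∑ a, ‖M a b‖ ^ 2 := fun b =>
    sum_norm_sq_inner v fun a => M a b
  -- An eigenvalue is the form of `M Mᴴ` at its unit eigenvector, the squared norm of `Mᴴ` applied
  -- to it.
  have hlam : ∀ i, hρ.eigenvalues i = ∑ b, ‖W i b‖ ^ 2 := by
    intro i
    rw [hρ.eigenvalues_eq, ← hv]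
    have h1 : star (⇑(v i)) ⬝ᵥ (ρ *ᵥ ⇑(v i)) = ∑ b, W i b * star (W i b) := by
      have h2 : (Mᴴ *ᵥ ⇑(v i)) = fun b => star (W i b) := by
        funext b
        simp [Matrix.mulVec, dotProduct, W, mul_comm]
      have h3 : star (⇑(v i)) ᵥ* M = fun b => W i b := by
        funext b
        simp [Matrix.vecMul, dotProduct, W]
      rw [hM, ← Matrix.mulVec_mulVec, Matrix.dotProduct_mulVec, h2, h3]
      rfl
    rw [h1, map_sum]
    refine Finset.sum_congr rfl fun b _ => ?_
    rw [Complex.star_def, Complex.mul_conj, Complex.normSq_eq_norm_sq]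
    exact Complex.ofReal_re _
  have hc : ∑ b ∈ G, ∑ a, ‖M a b‖ ^ 2 = c := by
    rw [← Finset.sum_fiberwise G label, Finset.sum_congr rfl fun k _ => hw k, Finset.sum_const,
      Finset.card_univ, nsmul_eq_mul, hL]
    field_simp
  have hc0 : 0 ≤ c := hc ▸ Finset.sum_nonneg fun b _ => Finset.sum_nonneg fun a _ => sq_nonneg _
  refine le_neg_sum_mul_logb (q := fun i => ∑ b ∈ G, ‖W i b‖ ^ 2) ?_ ?_ ?_ ?_ ?_
  · exact fun i => Finset.sum_nonneg fun b _ => sq_nonneg _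
  · intro i
    rw [hlam]
    exact Finset.sum_le_sum_of_subset_of_nonneg (Finset.subset_univ G) fun b _ _ => sq_nonneg _
  · simp only [hlam]
    rw [Finset.sum_comm]
    simp only [hpars, htr]
  · rw [Finset.sum_comm]
    simp only [hpars, hc]
  · intro i
    have hvi : ∑ a, ‖v i a‖ ^ 2 = 1 := by
      rw [← EuclideanSpace.norm_sq_eq, v.orthonormal.1 i, one_pow]
    have hCS : ∀ b ∈ G, ‖W i b‖ ^ 2 ≤ (∑ a ∈ P (label b), ‖v i a‖ ^ 2) * ∑ a, ‖M a b‖ ^ 2 := by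
      intro b hb
      have h1 : W i b = ∑ a ∈ P (label b), star (v i a) * M a b := by
        symm
        refine Finset.sum_subset (Finset.subset_univ _) fun a _ ha => ?_
        rw [not_imp_comm.1 (hsupp b hb a) ha, mul_zero]
      have h2 : ‖W i b‖ ≤ ∑ a ∈ P (label b), ‖v i a‖ * ‖M a b‖ := by
        rw [h1]
        refine (norm_sum_le _ _).trans (le_of_eq ?_)
        simp
      calc ‖W i b‖ ^ 2 ≤ (∑ a ∈ P (label b), ‖v i a‖ * ‖M a b‖) ^ 2 := by gcongr
        _ ≤ (∑ a ∈ P (label b), ‖v i a‖ ^ 2) * ∑ a ∈ P (label b), ‖M a b‖ ^ 2 :=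
          Finset.sum_mul_sq_le_sq_mul_sq _ _ _
        _ ≤ _ := by
          refine mul_le_mul_of_nonneg_left ?_ (Finset.sum_nonneg fun a _ => sq_nonneg _)
          exact Finset.sum_le_sum_of_subset_of_nonneg (Finset.subset_univ _)
            fun a _ _ => sq_nonneg _
    calc ∑ b ∈ G, ‖W i b‖ ^ 2
        ≤ ∑ b ∈ G, (∑ a ∈ P (label b), ‖v i a‖ ^ 2) * ∑ a, ‖M a b‖ ^ 2 :=
          Finset.sum_le_sum hCS
      _ = ∑ k, (∑ a ∈ P k, ‖v i a‖ ^ 2) * (c / 2 ^ s) := by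
          rw [← Finset.sum_fiberwise G label]
          refine Finset.sum_congr rfl fun k _ => ?_
          rw [← hw k, Finset.mul_sum]
          refine Finset.sum_congr rfl fun b hb => ?_
          rw [(Finset.mem_filter.1 hb).2]
      _ = (∑ k, ∑ a ∈ P k, ‖v i a‖ ^ 2) * (c / 2 ^ s) := by rw [Finset.sum_mul]
      _ ≤ 1 * (c / 2 ^ s) := by
          refine mul_le_mul_of_nonneg_right ?_ (by positivity)
          rw [← Finset.sum_biUnion fun k _ k' _ h => hP k k' h, ← hvi]
          exact Finset.sum_le_sum_of_subset_of_nonneg (Finset.subset_univ _)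
            fun a _ _ => sq_nonneg _
      _ = c / 2 ^ s := one_mul _

/-! ### Splitting the chain -/

section split

variable {n t : ℕ}

theorem glue_left (a : ChainState (n - t)) (b : ChainState t) {i : ℕ} (h : i < n - t) :
    glue (n := n) a b ⟨i, by omega⟩ = a ⟨i, h⟩ := by
  simp [glue, h]

theorem glue_right (ht : t ≤ n) (a : ChainState (n - t)) (b : ChainState t) {i : ℕ} (h : i < t) :
    glue (n := n) a b ⟨i + (n - t), by omega⟩ = b ⟨i, h⟩ := by
  simp [glue]

/-- A state of the chain is a pair of states of its two parts. -/
def glueEquiv (ht : t ≤ n) : ChainState (n - t) × ChainState t ≃ ChainState n where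
  toFun q := glue q.1 q.2
  invFun z := (fun i => z ⟨i, by omega⟩, fun i => z ⟨i + (n - t), by omega⟩)
  left_inv := by
    rintro ⟨a, b⟩
    refine Prod.ext ?_ ?_
    · funext i; exact glue_left a b i.isLt
    · funext i; exact glue_right ht a b i.isLt
  right_inv := by
    intro z
    funext i
    simp only [glue]
    split_ifs with h
    · rfl
    · congr 1
      exact Fin.ext (by simp only; omega)

theorem sum_glue {M : Type*} [AddCommMonoid M] (ht : t ≤ n) (F : ChainState n → M) :
    ∑ b : ChainState t, ∑ a : ChainState (n - t), F (glue a b) = ∑ z, F z := by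
  rw [Finset.sum_comm, ← Fintype.sum_prod_type']
  exact Equiv.sum_comp (glueEquiv ht) F

/-- The amplitudes of a state, as a matrix indexed by the two parts of the chain. -/
def amplitudes (t : ℕ) (ψ : ChainState n → ℂ) : Matrix (ChainState (n - t)) (ChainState t) ℂ :=
  fun a b => ψ (glue a b)

theorem reducedState_eq_mul (ψ : ChainState n → ℂ) :
    reducedState t ψ = amplitudes t ψ * (amplitudes t ψ)ᴴ := by
  ext a a'
  rw [Matrix.mul_apply]
  simp [reducedState, traceOutRight, densityMatrix, Matrix.vecMulVec, amplitudes]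

theorem disjoint_block {k s : ℕ} (h : s + 1 ≤ k) {y y' : Fin s → Bool} (hy : y ≠ y') :
    Disjoint (block k y) (block k y') := by
  rw [Finset.disjoint_left]
  intro a ha ha'
  simp only [block, Finset.mem_filter, Finset.mem_univ, true_and] at ha ha'
  refine hy (funext fun j => ?_)
  have := (ha j ⟨j + 1, by omega⟩ rfl).symm.trans (ha' j ⟨j + 1, by omega⟩ rfl)
  simpa using this

/-- The state of the particle at distance `j` to the left of the penultimate particle. -/
def endSite (b : ChainState t) (j : ℕ) : Site := if h : t - 2 - j < t then b ⟨t - 2 - j, h⟩ else .W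

/-- The bit of an entangled particle. -/
def bitOf : Site → Bool
  | .E y => y
  | _ => false

theorem endSite_eq {m s : ℕ} {a : ChainState (2 * m + 3 - t)} {b : ChainState t} (ht : s + 2 ≤ t)
    (htn : t ≤ 2 * m + 3) (j : Fin s) :
    endSite b j = glue (n := 2 * m + 3) a b ⟨2 * m + 1 - j, by omega⟩ := by
  have h : t - 2 - j.val < t := by omega
  rw [endSite, dif_pos h, ← glue_right htn a b h]
  congr 1
  exact Fin.ext (by simp only; omega)

end split

theorem endCount_le {m : ℕ} {c : Code} (hc : c ∈ codes m) : endCount c.1 c.2.1 ≤ c.1 := by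
  obtain ⟨a, κ, p⟩ := c
  exact (bounds_of_mem_codes hc).2.2.2.1

/-! ### Reading the first `s` bits from either end of the chain -/

section family

variable {m s : ℕ} {x : Fin m → Bool} {c : Code}

theorem codeState_end (hs : s ≤ m) (hc : c ∈ codes m) (h : s ≤ endCount c.1 c.2.1) (j : Fin s) :
    codeState m (bitAt x) c ⟨2 * m + 1 - j, by omega⟩ = .E (x (Fin.castLE hs j)) := by
  obtain ⟨a, κ, p⟩ := c
  have hb := bounds_of_mem_codes hc
  dsimp only at h
  have hj := j.isLt
  refine (conf_E hb.2.1 (by simp only; omega) (by simp only; omega) (by simp only; omega)).trans ?_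
  have e : 2 * m + 1 - (2 * m + 1 - j.val) = j.val := by omega
  simp only [e, bitAt]
  rw [dif_pos (by omega)]
  rfl

theorem le_endCount_of_codeState (hs : s ≤ m) (hc : c ∈ codes m)
    (h : ∀ j : Fin s, ∃ y, codeState m (bitAt x) c ⟨2 * m + 1 - j, by omega⟩ = .E y) :
    s ≤ endCount c.1 c.2.1 := by
  by_contra! hlt
  obtain ⟨a, κ, p⟩ := c
  have hb := bounds_of_mem_codes hc
  dsimp only at hlt
  -- The site just left of the block of `E`s is the one that cannot be in state `E`.
  obtain ⟨y, hy⟩ := h ⟨endCount a κ, hlt⟩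
  have hC := isControl_ctrl (bitAt x) a κ
  unfold codeState at hy
  dsimp only at hy
  have hcases := conf_cases (m := m) (X := bitAt x) (b := endCount a κ) (C := ctrl (bitAt x) a κ)
    hb.2.1 (2 * m + 1 - endCount a κ)
  rw [hy] at hcases
  rcases hcases with h | h | h | h | h | h | h | h | h <;> try omega
  · rw [← h.2] at hC; exact nomatch hC
  · exact absurd h.2.2.2 (by simp)

theorem codeState_start (hs : s ≤ m) (h : s ≤ c.1) (j : Fin s) :
    codeState m (bitAt x) c ⟨j + 1, by omega⟩ = .e (x (Fin.castLE hs j)) := by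
  have hj := j.isLt
  refine (conf_e (by simp) (by simp only; omega)).trans ?_
  simp only [Nat.add_sub_cancel, bitAt]
  rw [dif_pos (by omega)]
  rfl

variable {t : ℕ} {a : ChainState (2 * m + 3 - t)} {b : ChainState t}

/-- The bound on `t` keeps particles `1, …, s` (counted from zero) in the left part, where they are
`e`s showing the first `s` bits. -/
theorem mem_block_iff (hs : s ≤ m) (h : s ≤ c.1) (ht : t ≤ 2 * m + 3 - s - 2)
    (hz : glue a b = codeState m (bitAt x) c) (y : Fin s → Bool) :
    a ∈ block (2 * m + 3 - t) y ↔ ∀ j, x (Fin.castLE hs j) = y j := by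
  have hval : ∀ (j : Fin s) (i : Fin (2 * m + 3 - t)), i.val = j.val + 1 →
      a i = .e (x (Fin.castLE hs j)) := by
    intro j i hi
    rw [← codeState_start hs h j, ← hz, ← glue_left a b i.isLt]
    congr 1
    exact Fin.ext hi
  simp only [block, Finset.mem_filter, Finset.mem_univ, true_and]
  constructor
  · intro h' j
    have := (hval j ⟨j + 1, by omega⟩ rfl).symm.trans (h' j ⟨j + 1, by omega⟩ rfl)
    simpa using this
  · intro h' j i hi
    rw [hval j i hi, h']

/-- The traced-out particles alone decide whether at least `s` particles are in state `E`; this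
makes the good set of columns well defined. -/
theorem endSite_iff (hs : s ≤ m) (hc : c ∈ codes m) (ht : s + 2 ≤ t) (htn : t ≤ 2 * m + 3)
    (hz : glue a b = codeState m (bitAt x) c) :
    (∀ j : Fin s, ∃ y, endSite b j = .E y) ↔ s ≤ endCount c.1 c.2.1 := by
  simp only [endSite_eq (a := a) ht htn, hz]
  exact ⟨le_endCount_of_codeState hs hc, fun h j => ⟨_, codeState_end hs hc h j⟩⟩

theorem bitOf_endSite (hs : s ≤ m) (hc : c ∈ codes m) (ht : s + 2 ≤ t) (htn : t ≤ 2 * m + 3)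
    (hz : glue a b = codeState m (bitAt x) c) (h : s ≤ endCount c.1 c.2.1) (j : Fin s) :
    bitOf (endSite b j) = x (Fin.castLE hs j) := by
  rw [endSite_eq (a := a) ht htn, hz, codeState_end hs hc h]
  rfl

end family

/-! ### Prefix weights and the entropy of uniform superpositions over codes -/

theorem norm_sq_uniformSuperposition {ι : Type*} (S : Finset ι) (z : ι) [Decidable (z ∈ S)] :
    ‖uniformSuperposition S z‖ ^ 2 = if z ∈ S then (1 / S.card : ℝ) else 0 := by
  by_cases h : z ∈ S
  · rw [uniformSuperposition, if_pos h, if_pos h, Complex.norm_real, Real.norm_eq_abs, sq_abs,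
      div_pow, one_pow, Real.sq_sqrt (by positivity)]
  · simp [uniformSuperposition, h]

/-- The weight of the states with a given prefix at the positions `K'` of a uniform superposition
over the positions `K`. -/
theorem weight_prefix {m s : ℕ} (hs : s ≤ m) {K K' : Finset Code} (hK : K ⊆ codes m)
    (hK' : K' ⊆ codes m) (y : Fin s → Bool) :
    ((family m (Finset.univ.filter fun x : Fin m → Bool => ∀ j : Fin s, x (Fin.castLE hs j) = y j)
      K').card : ℝ) / (family m Finset.univ K).card = (K'.card / K.card : ℝ) / 2 ^ s := by
  rw [card_family hK', card_family hK, card_bits_prefix, Finset.card_univ, Fintype.card_fun,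
    Fintype.card_bool, Fintype.card_fin]
  obtain ⟨d, rfl⟩ := Nat.exists_eq_add_of_le hs
  rw [Nat.add_sub_cancel_left]
  push_cast
  rw [pow_add, div_div, mul_comm (K.card : ℝ), mul_comm (2 ^ s : ℝ), mul_assoc,
    mul_div_mul_left _ _ (by positivity)]

-- The good columns are the right halves ending in `s` particles in state `E`, labelled by the bits
-- they show; each forces the same bits on the left half. Stating this for arbitrary `K` covers both
-- the late part and the full ground state.
open Classical in
theorem le_entanglementEntropy {m s t : ℕ} (hs : s ≤ m) (ht : s + 2 ≤ t)
    (ht' : t ≤ 2 * m + 3 - s - 2) {K : Finset Code} (hK : K ⊆ codes m) (hne : K.Nonempty) :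
    ((K.filter fun c => s ≤ endCount c.1 c.2.1).card / K.card : ℝ) * s ≤
      entanglementEntropy t (uniformSuperposition (family m Finset.univ K)) := by
  have htn : t ≤ 2 * m + 3 := by omega
  have hS0 : ((family m Finset.univ K).card : ℝ) ≠ 0 := by
    exact_mod_cast (family_nonempty hne).card_pos.ne'
  refine le_vonNeumannEntropy (L := Fin s → Bool) _
    (amplitudes t (uniformSuperposition (family m Finset.univ K)))
    (reducedState_eq_mul _) ?_
    (Finset.univ.filter fun b => ∀ j : Fin s, ∃ y, endSite b j = .E y)
    (fun b j => bitOf (endSite b j)) (fun y => block (2 * m + 3 - t) y)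
    (fun y y' => disjoint_block (by omega)) ?_ (by simp) ?_
  · simp only [amplitudes]
    rw [sum_glue htn fun z => ‖uniformSuperposition (family m Finset.univ K) z‖ ^ 2]
    simp only [norm_sq_uniformSuperposition]
    rw [Finset.sum_ite_mem, Finset.univ_inter, Finset.sum_const, nsmul_eq_mul,
      mul_one_div_cancel hS0]
  · intro b hb a hab
    have hmem : glue a b ∈ family m Finset.univ K := by
      by_contra h
      exact hab (by simp [amplitudes, uniformSuperposition, h])
    obtain ⟨x, -, c, hc, hz⟩ := mem_family.1 hmem
    have hE := (endSite_iff hs (hK hc) ht htn hz).1 (Finset.mem_filter.1 hb).2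
    rw [mem_block_iff hs (hE.trans (endCount_le (hK hc))) ht' hz]
    exact fun j => (bitOf_endSite hs (hK hc) ht htn hz hE j).symm
  · intro y
    have hK' : (K.filter fun c => s ≤ endCount c.1 c.2.1) ⊆ codes m :=
      (Finset.filter_subset _ _).trans hK
    rw [← weight_prefix hs hK hK' y, Finset.filter_filter, Finset.sum_filter]
    have h1 : ∀ b : ChainState t, ∀ a : ChainState (2 * m + 3 - t),
        (if (∀ j : Fin s, ∃ y, endSite b j = .E y) ∧ (fun j : Fin s => bitOf (endSite b j)) = y
          then ‖uniformSuperposition (family m Finset.univ K) (glue a b)‖ ^ 2 else 0) =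
        if glue a b ∈ family m (Finset.univ.filter fun x : Fin m → Bool =>
          ∀ j : Fin s, x (Fin.castLE hs j) = y j) (K.filter fun c => s ≤ endCount c.1 c.2.1)
        then (1 / (family m Finset.univ K).card : ℝ) else 0 := by
      intro b a
      rw [norm_sq_uniformSuperposition, ← ite_and]
      refine if_congr ?_ rfl rfl
      simp only [mem_family, Finset.mem_filter, Finset.mem_univ, true_and]
      constructor
      · rintro ⟨⟨h1, rfl⟩, x, c, hc, hz⟩
        have hE := (endSite_iff hs (hK hc) ht htn hz).1 h1
        exact ⟨x, fun j => (bitOf_endSite hs (hK hc) ht htn hz hE j).symm, c, ⟨hc, hE⟩, hz⟩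
      · rintro ⟨x, hx, c, ⟨hc, hE⟩, hz⟩
        exact ⟨⟨(endSite_iff hs (hK hc) ht htn hz).2 hE,
          funext fun j => (bitOf_endSite hs (hK hc) ht htn hz hE j).trans (hx j)⟩, x, c, hc, hz⟩
    -- Summing over both halves turns the weight of label `y` into a count of the path states with
    -- prefix `y` and at least `s` particles in state `E`.
    have h2 : ∀ b : ChainState t,
        (if (∀ j : Fin s, ∃ y, endSite b j = .E y) ∧ (fun j : Fin s => bitOf (endSite b j)) = y
          then ∑ a : ChainState (2 * m + 3 - t),
            ‖uniformSuperposition (family m Finset.univ K) (glue a b)‖ ^ 2 else 0) =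
        ∑ a : ChainState (2 * m + 3 - t),
          if glue a b ∈ family m (Finset.univ.filter fun x : Fin m → Bool =>
            ∀ j : Fin s, x (Fin.castLE hs j) = y j) (K.filter fun c => s ≤ endCount c.1 c.2.1)
          then (1 / (family m Finset.univ K).card : ℝ) else 0 := by
      intro b
      rw [← Finset.sum_congr rfl fun a _ => h1 b a]
      split_ifs <;> simp
    simp only [amplitudes]
    rw [Finset.sum_congr rfl fun b _ => h2 b, sum_glue htn fun z => if z ∈ family m _ _ then _ else _,
      Finset.sum_ite_mem, Finset.univ_inter, Finset.sum_const, nsmul_eq_mul, mul_one_div]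

/-! ### The late part -/

theorem latePart_eq (m s : ℕ) : latePart m s =
    uniformSuperposition (family m Finset.univ ((codes m).filter fun c => s + 1 ≤ c.1)) := by
  rw [← late_eq_family]
  rfl

theorem earlyPart_eq (m s : ℕ) : earlyPart m s =
    uniformSuperposition (family m Finset.univ ((codes m).filter fun c => c.1 < s + 1)) := by
  rw [← early_eq_family]
  rfl

theorem late_nonempty {m s : ℕ} (hm : 1 ≤ m) (hs : 2 * s ≤ m) :
    ((codes m).filter fun c => s + 1 ≤ c.1).Nonempty := by
  refine ⟨⟨m, .up, m + 1⟩, ?_⟩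
  rw [Finset.mem_filter, mem_codes, mem_positions_up]
  exact ⟨⟨le_rfl, rfl⟩, show s + 1 ≤ m by omega⟩

/-- The number `c` is the late fraction of the codes. The early and late states partition the
support, and `√c` and `√(1 - c)` convert the amplitudes of the parts into that of the whole. -/
theorem groundState_eq_add {m s : ℕ} (hm : 1 ≤ m) (hs : 2 * s ≤ m) :
    ∃ c : ℝ, 1 / 4 ≤ c ∧ c ≤ 1 ∧
      groundState m = ((√(1 - c) : ℝ) : ℂ) • earlyPart m s + ((√c : ℝ) : ℂ) • latePart m s := by
  classical
  have hN : (0 : ℝ) < (codes m).card := by exact_mod_cast (codes_nonempty m).card_pos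
  have hL : (0 : ℝ) < ((codes m).filter fun c => s + 1 ≤ c.1).card := by
    exact_mod_cast (late_nonempty hm hs).card_pos
  have hE : (0 : ℝ) < ((codes m).filter fun c => c.1 < s + 1).card := by
    have : ((codes m).filter fun c => c.1 < s + 1).Nonempty :=
      ⟨⟨0, .up, 1⟩, by rw [Finset.mem_filter, mem_codes, mem_positions_up]; simp⟩
    exact_mod_cast this.card_pos
  have hsum : (((codes m).filter fun c => c.1 < s + 1).card : ℝ) +
      ((codes m).filter fun c => s + 1 ≤ c.1).card = (codes m).card := by
    have h3 := Finset.card_filter_add_card_filter_not (s := codes m) (fun c => c.1 < s + 1)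
    simp only [not_lt] at h3
    exact_mod_cast h3
  have hquarter : ((codes m).card : ℝ) ≤ 4 * ((codes m).filter fun c => s + 1 ≤ c.1).card := by
    exact_mod_cast card_codes_le m s hm hs
  have hmem : ∀ z : ChainState (2 * m + 3), ∀ (Q : Code → Prop) [DecidablePred Q],
      z ∈ family m Finset.univ ((codes m).filter Q) → z ∈ family m Finset.univ (codes m) := by
    intro z Q _ h
    obtain ⟨x, hx, c, hc, hz⟩ := mem_family.1 h
    exact mem_family.2 ⟨x, hx, c, (Finset.mem_filter.1 hc).1, hz⟩
  rw [earlyPart_eq, latePart_eq, groundState_eq_uniformSuperposition]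
  have hcE : ((family m Finset.univ ((codes m).filter fun c => c.1 < s + 1)).card : ℝ) =
      2 ^ m * ((codes m).filter fun c => c.1 < s + 1).card := by
    rw [card_family (Finset.filter_subset _ _)]; simp
  have hcL : ((family m Finset.univ ((codes m).filter fun c => s + 1 ≤ c.1)).card : ℝ) =
      2 ^ m * ((codes m).filter fun c => s + 1 ≤ c.1).card := by
    rw [card_family (Finset.filter_subset _ _)]; simp
  have hcN : ((family m Finset.univ (codes m)).card : ℝ) = 2 ^ m * (codes m).card := by
    rw [card_family subset_rfl]; simp
  have hsqrt : ∀ k N : ℝ, 0 < k → 0 < N →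
      1 / √(2 ^ m * N) = √(k / N) * (1 / √(2 ^ m * k)) := by
    intro k N hk hN
    rw [← mul_div_assoc, mul_one, ← Real.sqrt_div' _ (by positivity), one_div,
      ← Real.sqrt_inv]
    congr 1
    field_simp
  refine ⟨((codes m).filter fun c => s + 1 ≤ c.1).card / (codes m).card, ?_, ?_, ?_⟩
  · rw [le_div_iff₀ hN]; linarith
  · rw [div_le_one hN]; linarith
  · have h1c : (1 : ℝ) - ((codes m).filter fun c => s + 1 ≤ c.1).card / (codes m).card =
        ((codes m).filter fun c => c.1 < s + 1).card / (codes m).card := by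
      rw [eq_div_iff hN.ne', sub_mul, div_mul_cancel₀ _ hN.ne']; linarith
    rw [h1c]
    funext z
    simp only [Pi.add_apply, Pi.smul_apply, smul_eq_mul, uniformSuperposition, hcE, hcL, hcN]
    by_cases hz : z ∈ family m Finset.univ (codes m)
    · obtain ⟨x, -, c, hc, rfl⟩ := mem_family.1 hz
      have hiff : ∀ (Q : Code → Prop) [DecidablePred Q],
          codeState m (bitAt x) c ∈ family m Finset.univ ((codes m).filter Q) ↔ Q c := by
        intro Q _
        constructor
        · intro h
          obtain ⟨x', -, c', hc', he⟩ := mem_family.1 h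
          obtain ⟨hc', hQ⟩ := Finset.mem_filter.1 hc'
          exact (codeState_injective hc hc' he).2 ▸ hQ
        · exact fun h => mem_family.2
            ⟨x, Finset.mem_univ _, c, Finset.mem_filter.2 ⟨hc, h⟩, rfl⟩
      rw [if_pos hz]
      have h1 := hiff fun c => c.1 < s + 1
      have h2 := hiff fun c => s + 1 ≤ c.1
      by_cases hlt : c.1 < s + 1
      · rw [if_pos (h1.2 hlt), if_neg fun h => absurd (h2.1 h) (by omega),
          mul_zero, add_zero, ← Complex.ofReal_mul, ← hsqrt _ _ hE hN]
      · rw [if_neg fun h => hlt (h1.1 h), if_pos (h2.2 (by omega)),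
          mul_zero, zero_add, ← Complex.ofReal_mul, ← hsqrt _ _ hL hN]
    · rw [if_neg hz, if_neg fun h => hz (hmem z _ h), if_neg fun h => hz (hmem z _ h)]
      simp

section late

variable {m s t : ℕ}

/-- The number of `E`s lags behind that of the `e`s by at most one; this is why the late part starts
at `s + 1`. -/
theorem le_endCount_of_late {c : Code} (hc : c ∈ (codes m).filter fun c => s + 1 ≤ c.1) :
    c ∈ codes m ∧ s ≤ endCount c.1 c.2.1 ∧ s ≤ c.1 := by
  obtain ⟨h1, h2⟩ := Finset.mem_filter.1 hc
  obtain ⟨a, κ, p⟩ := c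
  have := bounds_of_mem_codes h1
  dsimp only at h2 ⊢
  exact ⟨h1, by omega, by omega⟩

/-- A nonzero entry needs one right half `b` compatible with both `a` and `a'`, and the `E`s in `b`
dictate the first bits of each. -/
theorem exists_block_of_reducedState_ne_zero (hs : s ≤ m) (ht : s + 2 ≤ t)
    (ht' : t ≤ 2 * m + 3 - s - 2) {a a' : ChainState (2 * m + 3 - t)}
    (h : reducedState t (latePart m s) a a' ≠ 0) :
    ∃ y : Fin s → Bool, a ∈ block (2 * m + 3 - t) y ∧ a' ∈ block (2 * m + 3 - t) y := by
  rw [reducedState_eq_mul, Matrix.mul_apply] at h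
  obtain ⟨b, -, hb⟩ := Finset.exists_ne_zero_of_sum_ne_zero h
  have h1 := left_ne_zero_of_mul hb
  have h2 := right_ne_zero_of_mul hb
  rw [Matrix.conjTranspose_apply, star_ne_zero] at h2
  rw [amplitudes, latePart_eq] at h1 h2
  refine ⟨fun j => bitOf (endSite b j), ?_⟩
  have key : ∀ a : ChainState (2 * m + 3 - t), uniformSuperposition
      (family m Finset.univ ((codes m).filter fun c => s + 1 ≤ c.1)) (glue a b) ≠ 0 →
      a ∈ block (2 * m + 3 - t) (fun j : Fin s => bitOf (endSite b j)) := by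
    intro a ha
    have hmem : glue a b ∈ family m Finset.univ ((codes m).filter fun c => s + 1 ≤ c.1) := by
      by_contra h
      exact ha (if_neg h)
    obtain ⟨x, -, c, hc, hz⟩ := mem_family.1 hmem
    obtain ⟨hc, hE, hs'⟩ := le_endCount_of_late hc
    rw [mem_block_iff hs hs' ht' hz]
    exact fun j => (bitOf_endSite hs hc ht (by omega) hz hE j).symm
  exact ⟨key a h1, key a' h2⟩

/-- The trace of a block is the fraction of late states whose bit string has prefix `y`. -/
theorem sum_block_reducedState (hm : 1 ≤ m) (hs : 2 * s ≤ m)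
    (ht' : t ≤ 2 * m + 3 - s - 2) (y : Fin s → Bool) :
    ∑ a ∈ block (2 * m + 3 - t) y, reducedState t (latePart m s) a a = 1 / 2 ^ s := by
  classical
  have hsm : s ≤ m := by omega
  have htn : t ≤ 2 * m + 3 := by omega
  obtain ⟨K, hK⟩ : ∃ K, K = (codes m).filter fun c => s + 1 ≤ c.1 := ⟨_, rfl⟩
  have hKs : K ⊆ codes m := hK ▸ Finset.filter_subset _ _
  have hKc : (K.card : ℝ) ≠ 0 := by
    rw [hK]; exact_mod_cast (late_nonempty hm hs).card_pos.ne'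
  have hw := weight_prefix hsm hKs hKs y
  rw [div_self hKc] at hw
  have hdiag : ∀ a : ChainState (2 * m + 3 - t), reducedState t (latePart m s) a a =
      ((∑ b : ChainState t, ‖latePart m s (glue a b)‖ ^ 2 : ℝ) : ℂ) := by
    intro a
    rw [reducedState_eq_mul, Matrix.mul_apply]
    push_cast
    refine Finset.sum_congr rfl fun b _ => ?_
    rw [Matrix.conjTranspose_apply, Complex.star_def, Complex.mul_conj,
      Complex.normSq_eq_norm_sq]
    push_cast
    rfl
  simp only [hdiag]
  rw [← Complex.ofReal_sum]
  have hreal : ∑ a ∈ block (2 * m + 3 - t) y, ∑ b : ChainState t,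
      ‖latePart m s (glue a b)‖ ^ 2 = 1 / 2 ^ s := by
    rw [← hw]
    have h1 : ∀ a : ChainState (2 * m + 3 - t), ∀ b : ChainState t,
        (if a ∈ block (2 * m + 3 - t) y then ‖latePart m s (glue a b)‖ ^ 2 else 0) =
        if glue a b ∈ family m (Finset.univ.filter fun x : Fin m → Bool =>
          ∀ j : Fin s, x (Fin.castLE hsm j) = y j) K
        then (1 / (family m Finset.univ K).card : ℝ) else 0 := by
      intro a b
      rw [latePart_eq, ← hK, norm_sq_uniformSuperposition, ← ite_and]
      refine if_congr ?_ rfl rfl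
      simp only [mem_family, Finset.mem_filter, Finset.mem_univ, true_and]
      constructor
      · rintro ⟨h1, x, c, hc, hz⟩
        exact ⟨x, (mem_block_iff hsm (le_endCount_of_late (hK ▸ hc)).2.2 ht' hz y).1 h1, c, hc, hz⟩
      · rintro ⟨x, hx, c, hc, hz⟩
        exact ⟨(mem_block_iff hsm (le_endCount_of_late (hK ▸ hc)).2.2 ht' hz y).2 hx, x, c, hc, hz⟩
    rw [Finset.sum_comm]
    have h2 : ∀ b : ChainState t, ∑ a ∈ block (2 * m + 3 - t) y, ‖latePart m s (glue a b)‖ ^ 2 =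
        ∑ a : ChainState (2 * m + 3 - t),
          if glue a b ∈ family m (Finset.univ.filter fun x : Fin m → Bool =>
            ∀ j : Fin s, x (Fin.castLE hsm j) = y j) K
          then (1 / (family m Finset.univ K).card : ℝ) else 0 := by
      intro b
      rw [← Finset.sum_congr rfl fun a _ => h1 a b, Finset.sum_ite_mem, Finset.univ_inter]
    rw [Finset.sum_congr rfl fun b _ => h2 b, sum_glue htn fun z => if z ∈ family m _ _ then _ else _,
      Finset.sum_ite_mem, Finset.univ_inter, Finset.sum_const, nsmul_eq_mul, mul_one_div]
  rw [hreal]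
  push_cast
  rfl

theorem le_entropy_latePart (hm : 1 ≤ m) (hs : 2 * s ≤ m) (ht : s + 2 ≤ t)
    (ht' : t ≤ 2 * m + 3 - s - 2) : (s : ℝ) ≤ entanglementEntropy t (latePart m s) := by
  have h := le_entanglementEntropy (s := s) (by omega) ht ht' (Finset.filter_subset _ _)
    (late_nonempty hm hs)
  rw [Finset.filter_true_of_mem (fun c hc => (le_endCount_of_late hc).2.1), div_self
    (by exact_mod_cast (late_nonempty hm hs).card_pos.ne'), one_mul, ← latePart_eq] at h
  exact h

theorem le_entropy_groundState (hm : 1 ≤ m) (hs : 2 * s ≤ m) (ht : s + 2 ≤ t)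
    (ht' : t ≤ 2 * m + 3 - s - 2) : (s : ℝ) / 4 ≤ entanglementEntropy t (groundState m) := by
  rw [groundState_eq_uniformSuperposition]
  refine le_trans ?_ (le_entanglementEntropy (s := s) (by omega) ht ht' subset_rfl
    (codes_nonempty m))
  have h1 : ((codes m).filter fun c => s + 1 ≤ c.1).card ≤
      ((codes m).filter fun c => s ≤ endCount c.1 c.2.1).card :=
    Finset.card_le_card fun c hc => Finset.mem_filter.2
      ⟨(le_endCount_of_late hc).1, (le_endCount_of_late hc).2.1⟩
  have h2 := card_codes_le m s hm hs
  have h3 : ((codes m).card : ℝ) ≤ 4 * ((codes m).filter fun c => s ≤ endCount c.1 c.2.1).card := by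
    exact_mod_cast h2.trans (Nat.mul_le_mul_left 4 h1)
  have hN : (0 : ℝ) < (codes m).card := by exact_mod_cast (codes_nonempty m).card_pos
  have h4 : (1 / 4 : ℝ) ≤
      ((codes m).filter fun c => s ≤ endCount c.1 c.2.1).card / (codes m).card := by
    rw [le_div_iff₀ hN]; linarith
  have h5 := mul_le_mul_of_nonneg_right h4 (Nat.cast_nonneg (α := ℝ) s)
  linarith

end late

end Chain

end

theorem mainTheorem2 :
    (∀ m : ℕ, IsGroundState (hamiltonian (2 * m + 3)) (groundState m)) ∧
    (∀ m s : ℕ, 1 ≤ m → 2 * s ≤ m →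
      (∃ c : ℝ, 1 / 4 ≤ c ∧ c ≤ 1 ∧
        groundState m = ((√(1 - c) : ℝ) : ℂ) • earlyPart m s + ((√c : ℝ) : ℂ) • latePart m s) ∧
      ∀ t : ℕ, s + 2 ≤ t → t ≤ 2 * m + 3 - s - 2 →
        (∀ y y' : Fin s → Bool, y ≠ y' →
          Disjoint (block (2 * m + 3 - t) y) (block (2 * m + 3 - t) y')) ∧
        (∀ a a' : ChainState (2 * m + 3 - t), reducedState t (latePart m s) a a' ≠ 0 →
          ∃ y : Fin s → Bool, a ∈ block (2 * m + 3 - t) y ∧ a' ∈ block (2 * m + 3 - t) y) ∧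
        (∀ y : Fin s → Bool,
          ∑ a ∈ block (2 * m + 3 - t) y, reducedState t (latePart m s) a a = 1 / 2 ^ s) ∧
        (s : ℝ) ≤ entanglementEntropy t (latePart m s) ∧
        (s : ℝ) / 4 ≤ entanglementEntropy t (groundState m)) ∧
    (∃ c : ℝ, 0 < c ∧ ∀ m t : ℕ, 2 ≤ m → m / 2 + 2 ≤ t → t ≤ 2 * m + 3 - m / 2 - 2 →
      c * (2 * m + 3 : ℕ) ≤ entanglementEntropy t (groundState m)) := by
  refine ⟨Chain.isGroundState_groundState, fun m s hm hs => ⟨Chain.groundState_eq_add hm hs,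
    fun t ht ht' => ⟨fun y y' => Chain.disjoint_block (by omega),
      fun a a' => Chain.exists_block_of_reducedState_ne_zero (by omega) ht ht',
      Chain.sum_block_reducedState hm hs ht', Chain.le_entropy_latePart hm hs ht ht',
      Chain.le_entropy_groundState hm hs ht ht'⟩⟩, 1 / 36, by norm_num, fun m t hm ht ht' => ?_⟩
  refine le_trans ?_ (Chain.le_entropy_groundState (s := m / 2) (by omega) (by omega) ht ht')
  -- With equality at `m = 3`; together with the factor `1 / 4` this gives the constant `1 / 36`.
  have h : ((2 * m + 3 : ℕ) : ℝ) ≤ 9 * ((m / 2 : ℕ) : ℝ) := by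
    exact_mod_cast (by omega : 2 * m + 3 ≤ 9 * (m / 2))
  linarith
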